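/- **Setting.** An instance of $Fm\,|\,\text{shortest path}\,|\,C_{\max}$ is a finite directed graph (parallel arcs allowed) with vertex set $V$ and arc set $A$, two distinct vertices $s,t$ joined by at least one directed $s$–$t$ path, and, for every arc $a$, a job with processing times $p_{1a},\dots,p_{ma}\ge 0$ on the $m\ge 1$ machines of a flow shop. A feasible solution is a simple directed $s$–$t$ path together with a non-preemptive flow shop schedule of the jobs on it; $C^*_{\max}$ is the minimum makespan. Put $$\rho=\begin{cases}\frac{2m}{3}& m\equiv 0\pmod 3,\\[2pt] \frac{2m+1}{3}& m\equiv 1\pmod 3,\\[2pt] \frac{4m+1}{6}& m\equiv 2\pmod 3.\end{cases}$$ **Sequencing.** *Johnson's rule* for times $a_j,b_j$: first the jobs with $a_j\le b_j$ by non-decreasing $a_j$, then the others by non-increasing $b_j$, ties broken arbitrarily. The *RS rule* on three machines is Johnson's rule for $a_j=p_{1j}+p_{2j}$, $b_j=p_{2j}+p_{3j}$. The jobs of a path are scheduled as follows: the machines are split into consecutive triples, followed by one pair if $m\equiv2$ or one single machine if $m\equiv1\pmod 3$; the machines of a triple all use one RS sequence, those of the pair one Johnson sequence, the single machine an arbitrary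 sequence; every machine processes its sequence as early as possible. **Path subroutine.** Given arc weights $w^1,\dots,w^m\ge0$, it returns an $s$–$t$ path $P$. A subroutine is called *$(1+\varepsilon)$-approximate* if always $\max_i w^i(P)\le(1+\varepsilon)\max_i w^i(P')$ for all $s$–$t$ paths $P'$. The *ABV subroutine* takes an $s$–$t$ path $Q$ that is shortest for the average of $w^1,\dots,w^m$, of average length $L$. If $L=0$ it returns $Q$; otherwise it returns an optimal path of the min-max shortest path problem with weights $\lfloor |V|\,w^i_a/(\varepsilon L)\rfloor$. **PAR algorithm.** Let $M=(1+\varepsilon)\sum_{a\in A}\sum_i p_{ia}+1$ and start with no job marked. Call the subroutine with $w^i_a=p_{ia}$ and schedule the jobs of the path as above. While the current path has no marked job and contains a job $j$ with $\sum_i p_{ij}>C'_{\max}/\rho$, where $C'_{\max}$ is the current makespan: mark all jobs $j$ of $A$ with $\sum_i p_{ij}>C'_{\max}/\rho$, set all $m$ weights of marked arcs to $M$, call the subroutine again and schedule the jobs of its path. Return the solution of smallest makespan $C_{\max}$ found. **Theorem 3.** Let $m\ge1$ and $\varepsilon>0$. 1. With the ABV subroutine, and likewise with any $(1+\varepsilon)$-approximate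 subroutine, every execution of PAR stops after at most $|A|$ passes through the loop and returns a feasible solution with $C_{\max}\le(1+\varepsilon)\rho\,C^*_{\max}$. 2. With the ABV subroutine, the worst-case ratio of PAR, i.e. the supremum of $C_{\max}/C^*_{\max}$ over all instances with $C^*_{\max}>0$ and all executions, is not less than $\rho$. 3. If the subroutine may return any $(1+\varepsilon)$-approximate path, the worst-case ratio of PAR is exactly $(1+\varepsilon)\rho$. -/

import Mathlib

namespace FlowShopPath

/-- `IsWalk src tgt u l v`: the list of arcs `l` is a directed walk from `u` to `v`. -/
def IsWalk {V A : Type} (src tgt : A → V) : V → List A → V → Prop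
  | u, [], v => u = v
  | u, a :: l, v => src a = u ∧ IsWalk src tgt (tgt a) l v

/-- A directed path: a directed walk that visits no vertex twice. -/
def IsPath {V A : Type} (src tgt : A → V) (u : V) (l : List A) (v : V) : Prop :=
  IsWalk src tgt u l v ∧ (u :: l.map tgt).Nodup

/-- An instance of `Fm | shortest path | C_max`: a finite directed (multi)graph with two
distinguished vertices `s`, `t` joined by some directed path; every arc is also a job,
with processing time `p i a ≥ 0` on machine `i`. -/
structure Inst (m : ℕ) where
  V : Type
  A : Type
  [fintypeV : Fintype V]
  [fintypeA : Fintype A]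
  [decEqA : DecidableEq A]
  src : A → V
  tgt : A → V
  s : V
  t : V
  s_ne_t : s ≠ t
  exists_path : ∃ P : List A, IsPath src tgt s P t
  p : Fin m → A → ℝ
  p_nonneg : ∀ i a, 0 ≤ p i a

attribute [instance] Inst.fintypeV Inst.fintypeA Inst.decEqA

variable {m : ℕ}

/-- The `s`-`t` directed paths of the instance. -/
def Inst.IsSTPath (I : Inst m) (P : List I.A) : Prop :=
  IsPath I.src I.tgt I.s P I.t

/-! ### Flow shop schedules -/

/-- `start i j` is the starting time of job `j` on machine `i`. The jobs of `S` are processed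
without preemption, each job visits the machines in the order `0, 1, …, m - 1`, and a machine
processes one job at a time. -/
def Inst.IsSchedule (I : Inst m) (S : Finset I.A) (start : Fin m → I.A → ℝ) : Prop :=
  (∀ i, ∀ j ∈ S, 0 ≤ start i j) ∧
  (∀ i i' : Fin m, (i : ℕ) + 1 = i' → ∀ j ∈ S, start i j + I.p i j ≤ start i' j) ∧
  (∀ i, ∀ j ∈ S, ∀ j' ∈ S, j ≠ j' →
    start i j + I.p i j ≤ start i j' ∨ start i j' + I.p i j' ≤ start i j)

/-- The largest completion time of a job of `S` (and `0` if there is no job). -/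
def Inst.makespan (I : Inst m) (S : Finset I.A) (start : Fin m → I.A → ℝ) : ℝ :=
  ((Finset.univ : Finset (Fin m)) ×ˢ S).fold max 0 (fun x => start x.1 x.2 + I.p x.1 x.2)

/-- A path together with starting times for its jobs. -/
structure Sol (I : Inst m) where
  path : List I.A
  start : Fin m → I.A → ℝ

/-- The jobs (arcs) of the path. -/
def Sol.jobs {I : Inst m} (x : Sol I) : Finset I.A := x.path.toFinset

/-- The makespan of a solution. -/
def Sol.cmax {I : Inst m} (x : Sol I) : ℝ := I.makespan x.jobs x.start

/-- Feasible solutions of the combined problem: an `s`-`t` path and a schedule of its jobs. -/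
def Sol.Feasible {I : Inst m} (x : Sol I) : Prop :=
  I.IsSTPath x.path ∧ I.IsSchedule x.jobs x.start

/-- The optimal makespan. -/
noncomputable def Inst.opt (I : Inst m) : ℝ :=
  sInf {c | ∃ x : Sol I, x.Feasible ∧ c = x.cmax}

/-! ### Sequencing rules -/

/-- `l` lists every job of `S` exactly once. -/
def IsOrderOf {A : Type} [DecidableEq A] (S : Finset A) (l : List A) : Prop :=
  l.Nodup ∧ l.toFinset = S

/-- Johnson's rule for a two-machine flow shop with processing times `a` and `b`: first the
jobs with `a ≤ b` by non-decreasing `a`, then the jobs with `a > b` by non-increasing `b`;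
ties are broken arbitrarily. -/
def IsJohnsonOrder {A : Type} [DecidableEq A] (a b : A → ℝ) (S : Finset A) (l : List A) :
    Prop :=
  IsOrderOf S l ∧ ∃ l₁ l₂ : List A, l = l₁ ++ l₂ ∧
    (∀ j ∈ l₁, a j ≤ b j) ∧ l₁.Pairwise (fun j k => a j ≤ a k) ∧
    (∀ j ∈ l₂, b j < a j) ∧ l₂.Pairwise (fun j k => b k ≤ b j)

/-- The RS rule for three machines: Johnson's rule for the aggregated times
`p₁ + p₂` and `p₂ + p₃`. -/
def IsRSOrder {A : Type} [DecidableEq A] (p₁ p₂ p₃ : A → ℝ) (S : Finset A) (l : List A) :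
    Prop :=
  IsJohnsonOrder (fun j => p₁ j + p₂ j) (fun j => p₂ j + p₃ j) S l

/-- The job sequences used on the machines (numbered from `0`): machines `3g, 3g+1, 3g+2` share
an RS sequence; if `m ≡ 2 (mod 3)`, the last two machines share a Johnson sequence; if
`m ≡ 1 (mod 3)`, the sequence on the last machine is arbitrary. -/
def Inst.IsSequencing (I : Inst m) (S : Finset I.A) (seq : Fin m → List I.A) : Prop :=
  (∀ i, IsOrderOf S (seq i)) ∧
  (∀ (g : ℕ) (i₁ i₂ i₃ : Fin m),
    (i₁ : ℕ) = 3 * g → (i₂ : ℕ) = 3 * g + 1 → (i₃ : ℕ) = 3 * g + 2 →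
      seq i₂ = seq i₁ ∧ seq i₃ = seq i₁ ∧
        IsRSOrder (I.p i₁) (I.p i₂) (I.p i₃) S (seq i₁)) ∧
  (m % 3 = 2 → ∀ i₁ i₂ : Fin m, (i₁ : ℕ) + 2 = m → (i₂ : ℕ) + 1 = m →
      seq i₂ = seq i₁ ∧ IsJohnsonOrder (I.p i₁) (I.p i₂) S (seq i₁))

/-- One machine that is free from time `c` on processes the listed jobs in the given order, each
as early as possible; `r j` is the time at which job `j` becomes available and `q j` its
processing time. The result is the starting time of each listed job. -/
noncomputable def seqStart {A : Type} [DecidableEq A] (q r : A → ℝ) : ℝ → List A → A → ℝ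
  | _, [] => fun _ => 0
  | c, a :: l => fun j =>
      if j = a then max c (r a) else seqStart q r (max c (r a) + q a) l j

/-- `I.ready seq i j`: the time at which job `j` has completed the first `i` machines, if every
machine follows its sequence as early as possible. -/
noncomputable def Inst.ready (I : Inst m) (seq : Fin m → List I.A) : ℕ → I.A → ℝ
  | 0 => fun _ => 0
  | i + 1 => fun j =>
      if h : i < m then
        seqStart (I.p ⟨i, h⟩) (I.ready seq i) 0 (seq ⟨i, h⟩) j + I.p ⟨i, h⟩ j
      else I.ready seq i j

/-- The starting times if every machine follows its sequence as early as possible. -/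
noncomputable def Inst.earliest (I : Inst m) (seq : Fin m → List I.A) : Fin m → I.A → ℝ :=
  fun i j => seqStart (I.p i) (I.ready seq i) 0 (seq i) j

/-! ### Min-max shortest paths -/

/-- `max_i ∑_{a ∈ P} w i a`. -/
def Inst.maxWeight (I : Inst m) (w : Fin m → I.A → ℝ) (P : List I.A) : ℝ :=
  (Finset.univ : Finset (Fin m)).fold max 0 (fun i => ∑ a ∈ P.toFinset, w i a)

/-- The average over `i` of `∑_{a ∈ P} w i a`. -/
noncomputable def Inst.avgWeight (I : Inst m) (w : Fin m → I.A → ℝ) (P : List I.A) : ℝ :=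
  (∑ i, ∑ a ∈ P.toFinset, w i a) / m

/-- A min-max shortest path subroutine: for each instance and each system of arc weights, the
set of paths that it may return. -/
def Subroutine (m : ℕ) : Type 1 :=
  (I : Inst m) → (Fin m → I.A → ℝ) → List I.A → Prop

/-- Any `(1+ε)`-approximate solution of the min-max shortest path problem. -/
def approxPath (ε : ℝ) : Subroutine m := fun I w P =>
  I.IsSTPath P ∧ ∀ P', I.IsSTPath P' → I.maxWeight w P ≤ (1 + ε) * I.maxWeight w P'

/-- The scaling scheme of Aissi, Bazgan and Vanderpooten. A shortest path `Q` for the averaged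
weights gives the lower bound `L` on the min-max value. If `L = 0`, then `Q` is returned.
Otherwise all weights are rounded down to multiples of `ε L / |V|`, and the integral min-max
shortest path problem so obtained is solved to optimality (by dynamic programming over vectors of
path lengths); which one of its optimal paths is returned is left open. -/
def abv (ε : ℝ) : Subroutine m := fun I w P =>
  ∃ Q, I.IsSTPath Q ∧ (∀ Q', I.IsSTPath Q' → I.avgWeight w Q ≤ I.avgWeight w Q') ∧
    ((I.avgWeight w Q = 0 ∧ P = Q) ∨
     (I.avgWeight w Q ≠ 0 ∧ I.IsSTPath P ∧ ∀ P', I.IsSTPath P' →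
        I.maxWeight (fun i a =>
            (⌊(Fintype.card I.V : ℝ) * w i a / (ε * I.avgWeight w Q)⌋ : ℝ)) P ≤
          I.maxWeight (fun i a =>
            (⌊(Fintype.card I.V : ℝ) * w i a / (ε * I.avgWeight w Q)⌋ : ℝ)) P'))

/-! ### The PAR algorithm -/

/-- The ratio `ρ`. -/
noncomputable def rho (m : ℕ) : ℝ :=
  if m % 3 = 0 then 2 * m / 3 else if m % 3 = 1 then (2 * m + 1) / 3 else (4 * m + 1) / 6

/-- The weight given to marked arcs. -/
def Inst.bigM (I : Inst m) (ε : ℝ) : ℝ :=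
  (1 + ε) * (∑ j, ∑ i, I.p i j) + 1

/-- The arc weights when the jobs in `D` are marked. -/
def Inst.weights (I : Inst m) (ε : ℝ) (D : Finset I.A) : Fin m → I.A → ℝ :=
  fun i a => if a ∈ D then I.bigM ε else I.p i a

/-- `x` may be obtained as the current solution while `D` is marked: call the subroutine with the
current weights, sequence the jobs of the path, and start them as early as possible. -/
def IsCurrent (sub : Subroutine m) (ε : ℝ) (I : Inst m) (D : Finset I.A) (x : Sol I) : Prop :=
  sub I (I.weights ε D) x.path ∧
    ∃ seq, I.IsSequencing x.jobs seq ∧ x.start = I.earliest seq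

/-- The variables of the algorithm: current solution, best solution so far, marked jobs. -/
structure State (I : Inst m) where
  cur : Sol I
  best : Sol I
  marked : Finset I.A

/-- Job `j` is large with respect to the current makespan. -/
def State.Large {I : Inst m} (σ : State I) (j : I.A) : Prop :=
  σ.cur.cmax / rho m < ∑ i, I.p i j

/-- The condition of the while loop. -/
def State.Guard {I : Inst m} (σ : State I) : Prop :=
  Disjoint σ.cur.jobs σ.marked ∧ ∃ j ∈ σ.cur.jobs, σ.Large j

/-- The states before the while loop. -/
def IsInit (sub : Subroutine m) (ε : ℝ) (I : Inst m) (σ : State I) : Prop :=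
  σ.marked = ∅ ∧ IsCurrent sub ε I ∅ σ.cur ∧ σ.best = σ.cur

/-- One pass through the body of the while loop: mark all large jobs, compute a new current
solution, and keep the better of it and the previous best one. -/
def IsStep (sub : Subroutine m) (ε : ℝ) (I : Inst m) (σ τ : State I) : Prop :=
  σ.Guard ∧ (∀ j, j ∈ τ.marked ↔ j ∈ σ.marked ∨ σ.Large j) ∧
    IsCurrent sub ε I τ.marked τ.cur ∧
    ((τ.cur.cmax < σ.best.cmax ∧ τ.best = τ.cur) ∨
     (σ.best.cmax ≤ τ.cur.cmax ∧ τ.best = σ.best))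

/-- `Reaches sub ε I k σ`: some execution is in state `σ` after `k` passes through the loop. -/
inductive Reaches (sub : Subroutine m) (ε : ℝ) (I : Inst m) : ℕ → State I → Prop
  | init (σ : State I) : IsInit sub ε I σ → Reaches sub ε I 0 σ
  | step (k : ℕ) (σ τ : State I) :
      Reaches sub ε I k σ → IsStep sub ε I σ τ → Reaches sub ε I (k + 1) τ

/-- Some execution of the PAR algorithm stops and returns `x`. -/
def Returns (sub : Subroutine m) (ε : ℝ) (I : Inst m) (x : Sol I) : Prop :=
  ∃ k σ, Reaches sub ε I k σ ∧ ¬ σ.Guard ∧ x = σ.best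

/-- The ratios `C_max / C*_max` that occur, over all instances with `m` machines and positive
optimal makespan and over all executions. -/
def ratios (m : ℕ) (sub : Subroutine m) (ε : ℝ) : Set ℝ :=
  {r | ∃ (I : Inst m) (x : Sol I), Returns sub ε I x ∧ 0 < I.opt ∧ r = x.cmax / I.opt}

end FlowShopPath

namespace FlowShopPath

/-! ### One machine -/

section SeqStart

variable {A : Type} [DecidableEq A] {q r : A → ℝ}

/-! Upper bound. Let `W` bound the machine loads of a path and `X` the total times of its jobs. By a
critical path argument a triple in RS order adds at most `W + max W X` to the completion times, a
pair in Johnson order `W + X / 2`, a single machine `W` (`ready_triple_le`, `ready_pair_le`,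
`ready_single_le`). The coefficients sum to `ρ` once `W ≤ X`, so a schedule of makespan `C` without
jobs longer than `C / ρ` has `C ≤ ρ W` (`makespan_earliest_le`).

When PAR has stopped, compare its best makespan `C` with any feasible solution `y`
(`Returns.feasible_and_le`). If `y` contains a marked job, that job alone takes longer than `C / ρ`.
Otherwise the weight `M` keeps the last path off marked arcs as well; the loop then ended because
that path has no large job, so `C ≤ ρ W`, and `W` is at most `1 + ε` times the makespan of `y`. The
loop is finite because each pass marks a new job.

Lower bound. A direct arc of work `β` competes with a long path of unit machine loads and job
lengths at most `1` (`tightInst`). The sequencing rules put jobs without work on a group first, so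
the group waits for the job that left the previous group last, and the makespan reaches `ρ`
(`rho_le_makespan`). No job is then large, so PAR stops at once with ratio at least `ρ / β`. The
long path is a legal answer of ABV for `β = 1`, and of an arbitrary approximate subroutine for `β =
1 / (1 + ε)`. -/

theorem le_seqStart (hq : ∀ k, 0 ≤ q k) (c : ℝ) (l : List A) {j : A} (hj : j ∈ l) :
    c ≤ seqStart q r c l j ∧ r j ≤ seqStart q r c l j := by
  induction l generalizing c with
  | nil => simp at hj
  | cons a l ih =>
    by_cases h : j = a
    · subst h
      simp [seqStart]
    · have hj' : j ∈ l := by simpa [h] using hj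
      obtain ⟨h1, h2⟩ := ih (max c (r a) + q a) hj'
      simp only [seqStart, h, if_false]
      exact ⟨by linarith [le_max_left c (r a), hq a], h2⟩

/-- `¬ R k j` forces `j` to precede `k`. With positions as `R` this gives feasibility of the
schedule; with a sorting key it gives the delays in the worst-case instances. -/
theorem seqStart_add_le {R : A → A → Prop} (hq : ∀ k, 0 ≤ q k) (c : ℝ) (l : List A)
    (hl : l.Pairwise R) {j k : A} (hj : j ∈ l) (hk : k ∈ l) (hjk : j ≠ k) (hR : ¬ R k j) :
    seqStart q r c l j + q j ≤ seqStart q r c l k := by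
  induction l generalizing c with
  | nil => simp at hj
  | cons a l ih =>
    rw [List.pairwise_cons] at hl
    by_cases h : j = a
    · subst h
      have hk' : k ∈ l := by simpa [Ne.symm hjk] using hk
      have := (le_seqStart (r := r) hq (max c (r j) + q j) l hk').1
      simpa [seqStart, Ne.symm hjk] using this
    · have hj' : j ∈ l := by simpa [h] using hj
      have hka : k ≠ a := by
        rintro rfl
        exact hR (hl.1 j hj')
      have hk' : k ∈ l := by simpa [hka] using hk
      simpa [seqStart, h, hka] using ih (max c (r a) + q a) hl.2 hj' hk'

theorem pairwise_idxOf {l : List A} (hl : l.Nodup) :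
    l.Pairwise (fun a b => l.idxOf a < l.idxOf b) := by
  rw [List.pairwise_iff_getElem]
  intro i j hi hj hij
  rwa [hl.idxOf_getElem, hl.idxOf_getElem]

/-- The completion time of a job is bounded by a block of consecutive jobs that ends with it and
is preceded by idle time or by the time `c`. -/
theorem seqStart_critical_aux (hq : ∀ k, 0 ≤ q k) (pos : A → ℕ) (c : ℝ) (l : List A)
    (hl : l.Pairwise (fun a b => pos a < pos b)) {j : A} (hj : j ∈ l) :
    seqStart q r c l j + q j ≤ c + ∑ k ∈ l.toFinset with pos k ≤ pos j, q k ∨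
    ∃ u ∈ l, pos u ≤ pos j ∧
      seqStart q r c l j + q j ≤
        r u + ∑ k ∈ l.toFinset with pos u ≤ pos k ∧ pos k ≤ pos j, q k := by
  induction l generalizing c with
  | nil => simp at hj
  | cons a l ih =>
    rw [List.pairwise_cons] at hl
    by_cases h : j = a
    · subst h
      have e : seqStart q r c (j :: l) j = max c (r j) := by simp [seqStart]
      rw [e]
      rcases le_total c (r j) with hc | hc
      · right
        refine ⟨j, by simp, le_rfl, ?_⟩
        rw [max_eq_right hc]
        have : q j ≤ ∑ k ∈ (j :: l).toFinset with pos j ≤ pos k ∧ pos k ≤ pos j, q k :=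
          Finset.single_le_sum (f := q) (fun k _ => hq k) (by simp)
        linarith
      · left
        rw [max_eq_left hc]
        have : q j ≤ ∑ k ∈ (j :: l).toFinset with pos k ≤ pos j, q k :=
          Finset.single_le_sum (f := q) (fun k _ => hq k) (by simp)
        linarith
    · have hj' : j ∈ l := by simpa [h] using hj
      have haj := hl.1 j hj'
      have hal : a ∉ l := fun ha => lt_irrefl _ (hl.1 a ha)
      have e : seqStart q r c (a :: l) j = seqStart q r (max c (r a) + q a) l j := by
        simp [seqStart, h]
      rw [e]
      have hsum : ∑ k ∈ (a :: l).toFinset with pos k ≤ pos j, q k =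
          q a + ∑ k ∈ l.toFinset with pos k ≤ pos j, q k := by
        rw [List.toFinset_cons, Finset.filter_insert, if_pos haj.le, Finset.sum_insert]
        simp [hal]
      rcases ih (max c (r a) + q a) hl.2 hj' with h1 | ⟨u, hu, huj, h1⟩
      · rcases le_total c (r a) with hc | hc
        · right
          refine ⟨a, by simp, haj.le, ?_⟩
          have : ∑ k ∈ (a :: l).toFinset with pos a ≤ pos k ∧ pos k ≤ pos j, q k =
              ∑ k ∈ (a :: l).toFinset with pos k ≤ pos j, q k := by
            congr 1
            apply Finset.filter_congr
            intro k hk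
            rw [List.mem_toFinset, List.mem_cons] at hk
            rcases hk with rfl | hk
            · simp
            · simp [(hl.1 k hk).le]
          rw [max_eq_right hc] at h1
          rw [max_eq_right hc, this, hsum]
          linarith
        · left
          rw [max_eq_left hc] at h1
          rw [max_eq_left hc, hsum]
          linarith
      · right
        refine ⟨u, by simp [hu], huj, h1.trans ?_⟩
        refine add_le_add le_rfl (Finset.sum_le_sum_of_subset_of_nonneg (fun k => ?_)
          fun k _ _ => hq k)
        simp only [Finset.mem_filter, List.mem_toFinset, List.mem_cons]
        tauto

/-- A block that starts at time `0` can be charged to the head of the list, whose release time is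
nonnegative. -/
theorem seqStart_critical (hq : ∀ k, 0 ≤ q k) (pos : A → ℕ) (l : List A)
    (hr : ∀ k ∈ l, 0 ≤ r k)
    (hl : l.Pairwise (fun a b => pos a < pos b)) {j : A} (hj : j ∈ l) :
    ∃ u ∈ l, pos u ≤ pos j ∧
      seqStart q r 0 l j + q j ≤
        r u + ∑ k ∈ l.toFinset with pos u ≤ pos k ∧ pos k ≤ pos j, q k := by
  rcases seqStart_critical_aux (r := r) hq pos 0 l hl hj with h | h
  · obtain ⟨a, l, rfl⟩ := List.exists_cons_of_ne_nil (List.ne_nil_of_mem hj)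
    rw [List.pairwise_cons] at hl
    have ha : ∀ k ∈ a :: l, pos a ≤ pos k := by
      intro k hk
      rcases List.mem_cons.1 hk with rfl | hk
      · exact le_rfl
      · exact (hl.1 k hk).le
    refine ⟨a, by simp, ha j hj, h.trans ?_⟩
    have : ∑ k ∈ (a :: l).toFinset with pos a ≤ pos k ∧ pos k ≤ pos j, q k =
        ∑ k ∈ (a :: l).toFinset with pos k ≤ pos j, q k := by
      congr 1
      apply Finset.filter_congr
      intro k hk
      simp [ha k (List.mem_toFinset.1 hk)]
    rw [this]
    linarith [hr a (by simp)]
  · exact h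

end SeqStart

/-! ### Johnson sequences -/

section Johnson

variable {A : Type} [DecidableEq A]

theorem exists_sorted_order (f : A → ℝ) (S : Finset A) :
    ∃ l, IsOrderOf S l ∧ l.Pairwise (fun j k => f j ≤ f k) := by
  induction S using Finset.strongInduction with
  | H S ih =>
    rcases S.eq_empty_or_nonempty with rfl | hS
    · exact ⟨[], by simp [IsOrderOf], List.Pairwise.nil⟩
    · obtain ⟨a, ha, hmin⟩ := S.exists_min_image f hS
      obtain ⟨l, ⟨h1, h2⟩, h3⟩ := ih _ (Finset.erase_ssubset ha)
      have hmem : ∀ k, k ∈ l ↔ k ≠ a ∧ k ∈ S := fun k => by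
        rw [← List.mem_toFinset, h2, Finset.mem_erase]
      refine ⟨a :: l, ⟨List.nodup_cons.2 ⟨by simp [hmem], h1⟩, ?_⟩,
        List.pairwise_cons.2 ⟨fun k hk => hmin k ((hmem k).1 hk).2, h3⟩⟩
      rw [List.toFinset_cons, h2, Finset.insert_erase ha]

theorem exists_johnsonOrder (a b : A → ℝ) (S : Finset A) : ∃ l, IsJohnsonOrder a b S l := by
  obtain ⟨l₁, ⟨h1, h2⟩, h3⟩ := exists_sorted_order a {j ∈ S | a j ≤ b j}
  obtain ⟨l₂, ⟨k1, k2⟩, k3⟩ := exists_sorted_order (fun j => - b j) {j ∈ S | ¬ a j ≤ b j}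
  have m1 : ∀ j, j ∈ l₁ ↔ j ∈ S ∧ a j ≤ b j := fun j => by
    rw [← List.mem_toFinset, h2, Finset.mem_filter]
  have m2 : ∀ j, j ∈ l₂ ↔ j ∈ S ∧ ¬ a j ≤ b j := fun j => by
    rw [← List.mem_toFinset, k2, Finset.mem_filter]
  refine ⟨l₁ ++ l₂, ⟨List.nodup_append'.2 ⟨h1, k1, ?_⟩, ?_⟩, l₁, l₂, rfl,
    fun j hj => ((m1 j).1 hj).2, h3, fun j hj => not_le.1 ((m2 j).1 hj).2,
    k3.imp fun h => by linarith⟩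
  · intro j hj hj'
    exact ((m2 j).1 hj').2 ((m1 j).1 hj).2
  · rw [List.toFinset_append, h2, k2, Finset.filter_union_filter_not_eq]

theorem IsOrderOf.mem_iff {S : Finset A} {l : List A} (h : IsOrderOf S l) {j : A} :
    j ∈ l ↔ j ∈ S := by
  rw [← h.2, List.mem_toFinset]

/-- All that the upper bound needs of Johnson's rule: either everything up to `u` lies in the first
part, or everything from `u` on lies in the second. The sorting within the parts plays no role. -/
theorem IsJohnsonOrder.dichotomy {a b : A → ℝ} {S : Finset A} {l : List A}
    (h : IsJohnsonOrder a b S l) (u : A) :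
    (∀ k ∈ S, l.idxOf k ≤ l.idxOf u → a k ≤ b k) ∨
    (∀ k ∈ S, l.idxOf u ≤ l.idxOf k → b k ≤ a k) := by
  obtain ⟨ho, l₁, l₂, rfl, h1, -, h2, -⟩ := h
  by_cases hu : u ∈ l₁
  · left
    intro k _ hk
    apply h1
    by_contra hkl
    rw [List.idxOf_append_of_mem hu, List.idxOf_append_of_notMem hkl] at hk
    have := List.idxOf_lt_length_of_mem hu
    omega
  · right
    intro k hkS hk
    have hk' := ho.mem_iff.2 hkS
    rw [List.mem_append] at hk'
    rcases hk' with hkl | hkl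
    · rw [List.idxOf_append_of_mem hkl, List.idxOf_append_of_notMem hu] at hk
      have := List.idxOf_lt_length_of_mem hkl
      omega
    · exact (h2 k hkl).le

/-- The second part is empty. This fixes the order, up to ties, in the worst-case instances. -/
theorem IsJohnsonOrder.pairwise_of_eq {a b : A → ℝ} {S : Finset A} {l : List A}
    (hab : ∀ j ∈ S, a j = b j) (h : IsJohnsonOrder a b S l) : l.Pairwise (fun j k => a j ≤ a k) := by
  obtain ⟨ho, l₁, l₂, rfl, -, h1, h2, -⟩ := h
  have : l₂ = [] := List.eq_nil_iff_forall_not_mem.2 fun j hj => (h2 j hj).ne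
    (hab j (ho.mem_iff.1 (List.mem_append_right _ hj))).symm
  simpa [this] using h1

variable {S : Finset A} {pos : A → ℕ} {W X : ℝ}

/-- A critical path that changes machines at `u`. In the first case `a` may be replaced by `b`
before `u`, which leaves one full load plus `a u`, and `a u ≤ b u` makes this extra term at most `X
/ 2`. The second case is symmetric. -/
theorem two_machine_bound {a b : A → ℝ} (hpos : Set.InjOn pos S)
    {u : A} (hu : u ∈ S)
    (hJ : (∀ k ∈ S, pos k ≤ pos u → a k ≤ b k) ∨ (∀ k ∈ S, pos u ≤ pos k → b k ≤ a k))
    (hWa : ∑ k ∈ S, a k ≤ W) (hWb : ∑ k ∈ S, b k ≤ W) (hX : a u + b u ≤ X) :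
    ∑ k ∈ S with pos k ≤ pos u, a k + ∑ k ∈ S with pos u ≤ pos k, b k ≤ W + X / 2 := by
  rw [Finset.sum_filter, Finset.sum_filter, ← Finset.sum_add_distrib]
  rcases hJ with hJ | hJ
  · have hle : ∀ k ∈ S, ((if pos k ≤ pos u then a k else 0) + if pos u ≤ pos k then b k else 0) ≤
        b k + if k = u then a u else 0 := by
      intro k hk
      by_cases hku : k = u
      · subst hku; simp; linarith
      · have : pos k ≠ pos u := fun h => hku (hpos hk hu h)
        rw [if_neg hku]
        rcases lt_or_gt_of_ne this with h | h
        · rw [if_pos h.le, if_neg (by omega)]; linarith [hJ k hk h.le]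
        · rw [if_neg (by omega), if_pos h.le]; linarith
    refine (Finset.sum_le_sum hle).trans ?_
    rw [Finset.sum_add_distrib, Finset.sum_ite_eq' S u, if_pos hu]
    linarith [hJ u hu le_rfl]
  · have hle : ∀ k ∈ S, ((if pos k ≤ pos u then a k else 0) + if pos u ≤ pos k then b k else 0) ≤
        a k + if k = u then b u else 0 := by
      intro k hk
      by_cases hku : k = u
      · subst hku; simp
      · have : pos k ≠ pos u := fun h => hku (hpos hk hu h)
        rw [if_neg hku]
        rcases lt_or_gt_of_ne this with h | h
        · rw [if_pos h.le, if_neg (by omega)]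
        · rw [if_neg (by omega), if_pos h.le]; linarith [hJ k hk h.le]
    refine (Finset.sum_le_sum hle).trans ?_
    rw [Finset.sum_add_distrib, Finset.sum_ite_eq' S u, if_pos hu]
    linarith [hJ u hu le_rfl]

/-- A critical path that changes machines at `u` and `v`. If `u = v`, the outer machines contribute
at most `W + a u + c u` and the middle one `b u`. Otherwise the two outer blocks are disjoint and
the dichotomy compares both with the same machine, so they contribute at most `W`, and so does the
middle machine. -/
theorem three_machine_bound {a b c : A → ℝ} (hpos : Set.InjOn pos S)
    (ha : ∀ k, 0 ≤ a k) (hb : ∀ k, 0 ≤ b k) (hc : ∀ k, 0 ≤ c k) {u v : A} (hu : u ∈ S)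
    (huv : pos u ≤ pos v) (hv : v ∈ S)
    (hJ : (∀ k ∈ S, pos k ≤ pos u → a k ≤ c k) ∨ (∀ k ∈ S, pos u ≤ pos k → c k ≤ a k))
    (hWa : ∑ k ∈ S, a k ≤ W) (hWb : ∑ k ∈ S, b k ≤ W) (hWc : ∑ k ∈ S, c k ≤ W)
    (hX : a u + b u + c u ≤ X) :
    ∑ k ∈ S with pos k ≤ pos u, a k + ∑ k ∈ S with pos u ≤ pos k ∧ pos k ≤ pos v, b k +
      ∑ k ∈ S with pos v ≤ pos k, c k ≤ W + max W X := by
  rcases huv.eq_or_lt with h | h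
  · have huv' : u = v := hpos hu hv h
    subst huv'
    have hmid : ∑ k ∈ S with pos u ≤ pos k ∧ pos k ≤ pos u, b k = b u := by
      rw [Finset.sum_eq_single_of_mem u (by simp [hu])]
      intro k hk hku
      rw [Finset.mem_filter] at hk
      exact absurd (hpos hk.1 hu (le_antisymm hk.2.2 hk.2.1)) hku
    have := two_machine_bound hpos hu hJ hWa hWc le_rfl
    have hmax := le_max_right W X
    have key : ∑ k ∈ S with pos k ≤ pos u, a k + ∑ k ∈ S with pos u ≤ pos k, c k ≤
        W + (a u + c u) := this.trans (by linarith [ha u, hc u])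
    linarith
  · have hmid : ∑ k ∈ S with pos u ≤ pos k ∧ pos k ≤ pos v, b k ≤ W :=
      (Finset.sum_le_sum_of_subset_of_nonneg (Finset.filter_subset _ _)
        fun k _ _ => hb k).trans hWb
    have hout : ∑ k ∈ S with pos k ≤ pos u, a k + ∑ k ∈ S with pos v ≤ pos k, c k ≤ W := by
      rw [Finset.sum_filter, Finset.sum_filter, ← Finset.sum_add_distrib]
      rcases hJ with hJ | hJ
      · refine le_trans (Finset.sum_le_sum fun k hk => ?_) hWc
        have := hJ k hk
        have := hc k
        split_ifs with h1 h2 h2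
        · omega
        · linarith [hJ k hk h1]
        · linarith
        · linarith
      · refine le_trans (Finset.sum_le_sum fun k hk => ?_) hWa
        have := ha k
        split_ifs with h1 h2 h2
        · omega
        · linarith
        · linarith [hJ k hk (by omega)]
        · linarith
    linarith [le_max_left W X]

end Johnson

/-! ### Schedules -/

section Schedule

variable {m : ℕ} {I : Inst m} {S : Finset I.A} {seq : Fin m → List I.A}

theorem ready_succ (i : Fin m) (j : I.A) :
    I.ready seq (i + 1) j = I.earliest seq i j + I.p i j := by
  simp [Inst.ready, Inst.earliest]

theorem ready_le_earliest (hseq : ∀ i, IsOrderOf S (seq i)) (i : Fin m) {j : I.A} (hj : j ∈ S) :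
    I.ready seq i j ≤ I.earliest seq i j :=
  (le_seqStart (I.p_nonneg i) 0 _ ((hseq i).mem_iff.2 hj)).2

theorem earliest_nonneg (hseq : ∀ i, IsOrderOf S (seq i)) (i : Fin m) {j : I.A} (hj : j ∈ S) :
    0 ≤ I.earliest seq i j :=
  (le_seqStart (I.p_nonneg i) 0 _ ((hseq i).mem_iff.2 hj)).1

theorem ready_mono_succ (hseq : ∀ i, IsOrderOf S (seq i)) (i : ℕ) {j : I.A} (hj : j ∈ S) :
    I.ready seq i j ≤ I.ready seq (i + 1) j := by
  by_cases h : i < m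
  · have h1 := ready_le_earliest hseq ⟨i, h⟩ hj
    have h2 := ready_succ (seq := seq) ⟨i, h⟩ j
    have h3 := I.p_nonneg ⟨i, h⟩ j
    simp only at h1 h2
    linarith
  · simp [Inst.ready, h]

theorem ready_mono (hseq : ∀ i, IsOrderOf S (seq i)) {j : I.A} (hj : j ∈ S) :
    Monotone fun i => I.ready seq i j :=
  monotone_nat_of_le_succ fun i => ready_mono_succ hseq i hj

theorem ready_nonneg (hseq : ∀ i, IsOrderOf S (seq i)) (i : ℕ) {j : I.A} (hj : j ∈ S) :
    0 ≤ I.ready seq i j :=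
  ready_mono hseq hj (Nat.zero_le i)

theorem isSchedule_earliest (hseq : ∀ i, IsOrderOf S (seq i)) :
    I.IsSchedule S (I.earliest seq) := by
  refine ⟨fun i j hj => earliest_nonneg hseq i hj, fun i i' hi j hj => ?_,
    fun i j hj j' hj' hne => ?_⟩
  · rw [← ready_succ, hi]
    exact ready_le_earliest hseq i' hj
  · have hp := pairwise_idxOf (hseq i).1
    have h1 := (hseq i).mem_iff.2 hj
    have h2 := (hseq i).mem_iff.2 hj'
    rcases le_total ((seq i).idxOf j) ((seq i).idxOf j') with h | h
    · exact Or.inl (seqStart_add_le (I.p_nonneg i) 0 _ hp h1 h2 hne (by omega))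
    · exact Or.inr (seqStart_add_le (I.p_nonneg i) 0 _ hp h2 h1 hne.symm (by omega))

/-! ### Lower bounds on the makespan: machine loads and job lengths. -/

theorem makespan_le_iff {start : Fin m → I.A → ℝ} {c : ℝ} :
    I.makespan S start ≤ c ↔ 0 ≤ c ∧ ∀ i, ∀ j ∈ S, start i j + I.p i j ≤ c := by
  simp [Inst.makespan, Finset.fold_max_le]

theorem makespan_nonneg (start : Fin m → I.A → ℝ) : 0 ≤ I.makespan S start :=
  (makespan_le_iff.1 le_rfl).1

theorem le_makespan (start : Fin m → I.A → ℝ) (i : Fin m) {j : I.A} (hj : j ∈ S) :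
    start i j + I.p i j ≤ I.makespan S start :=
  (makespan_le_iff.1 le_rfl).2 i j hj

theorem maxWeight_le_iff {w : Fin m → I.A → ℝ} {P : List I.A} {c : ℝ} :
    I.maxWeight w P ≤ c ↔ 0 ≤ c ∧ ∀ i, ∑ a ∈ P.toFinset, w i a ≤ c := by
  simp [Inst.maxWeight, Finset.fold_max_le]

theorem maxWeight_nonneg (w : Fin m → I.A → ℝ) (P : List I.A) : 0 ≤ I.maxWeight w P :=
  (maxWeight_le_iff.1 le_rfl).1

theorem le_maxWeight (w : Fin m → I.A → ℝ) (P : List I.A) (i : Fin m) :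
    ∑ a ∈ P.toFinset, w i a ≤ I.maxWeight w P :=
  (maxWeight_le_iff.1 le_rfl).2 i

/-- The load of a set of jobs that one machine processes without overlap in `[0, c]` is at most
`c`. -/
theorem sum_le_of_disjoint {A : Type} [DecidableEq A] (q s : A → ℝ) (hq : ∀ j, 0 ≤ q j)
    (T : Finset A) (c : ℝ) (hc : 0 ≤ c) (h0 : ∀ j ∈ T, 0 ≤ s j) (hT : ∀ j ∈ T, s j + q j ≤ c)
    (hd : ∀ j ∈ T, ∀ k ∈ T, j ≠ k → s j + q j ≤ s k ∨ s k + q k ≤ s j) :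
    ∑ j ∈ T, q j ≤ c := by
  -- Jobs of length zero are dropped, so that the job with the largest start is really last: nothing
  -- else can start after it ends.
  have hpos : ∑ j ∈ T, q j = ∑ j ∈ T with 0 < q j, q j := by
    rw [Finset.sum_filter]
    refine Finset.sum_congr rfl fun j _ => ?_
    split_ifs with h
    · rfl
    · linarith [hq j]
  have key : ∀ (U : Finset A) (c : ℝ), 0 ≤ c → U ⊆ T → (∀ j ∈ U, 0 < q j) →
      (∀ j ∈ U, s j + q j ≤ c) → ∑ j ∈ U, q j ≤ c := by
    intro U
    induction U using Finset.strongInduction with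
    | H U ih =>
      intro c hc hU hUp hUc
      rcases U.eq_empty_or_nonempty with rfl | hne
      · simpa using hc
      · obtain ⟨a, ha, hmax⟩ := U.exists_max_image s hne
        have := ih _ (Finset.erase_ssubset ha) (s a) (h0 a (hU ha))
          ((Finset.erase_subset a U).trans hU)
          (fun j hj => hUp j (Finset.mem_of_mem_erase hj)) (fun j hj => by
            have hjU := Finset.mem_of_mem_erase hj
            rcases hd j (hU hjU) a (hU ha) (Finset.ne_of_mem_erase hj) with h | h
            · exact h
            · linarith [hmax j hjU, hUp a ha])
        rw [← Finset.sum_erase_add _ _ ha]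
        linarith [hUc a ha]
  rw [hpos]
  exact key _ c hc (Finset.filter_subset _ _) (fun j hj => (Finset.mem_filter.1 hj).2)
    fun j hj => hT j (Finset.mem_filter.1 hj).1

theorem sum_jobs_le_makespan {start : Fin m → I.A → ℝ} (h : I.IsSchedule S start) (i : Fin m) :
    ∑ j ∈ S, I.p i j ≤ I.makespan S start :=
  sum_le_of_disjoint (I.p i) (start i) (I.p_nonneg i) S _ (makespan_nonneg _) (h.1 i)
    (fun _ hj => le_makespan start i hj) (h.2.2 i)

theorem maxWeight_le_cmax {x : Sol I} (hx : x.Feasible) : I.maxWeight I.p x.path ≤ x.cmax :=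
  maxWeight_le_iff.2 ⟨makespan_nonneg _, fun i => sum_jobs_le_makespan hx.2 i⟩

theorem sum_machines_le_makespan {start : Fin m → I.A → ℝ} (h : I.IsSchedule S start) {j : I.A}
    (hj : j ∈ S) : ∑ i, I.p i j ≤ I.makespan S start := by
  rcases m with _ | n
  · simpa using makespan_nonneg start
  have key : ∀ k : ℕ, ∀ hk : k < n + 1,
      ∑ i ∈ Finset.univ.filter (fun i : Fin (n + 1) => (i : ℕ) ≤ k), I.p i j ≤
        start ⟨k, hk⟩ j + I.p ⟨k, hk⟩ j := by
    intro k
    induction k with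
    | zero =>
      intro hk
      have : Finset.univ.filter (fun i : Fin (n + 1) => (i : ℕ) ≤ 0) = {⟨0, hk⟩} := by
        ext i
        simp only [Finset.mem_filter, Finset.mem_univ, true_and, Finset.mem_singleton, Fin.ext_iff]
        omega
      rw [this, Finset.sum_singleton]
      linarith [h.1 ⟨0, hk⟩ j hj]
    | succ k ih =>
      intro hk
      have : Finset.univ.filter (fun i : Fin (n + 1) => (i : ℕ) ≤ k + 1) =
          insert ⟨k + 1, hk⟩ (Finset.univ.filter (fun i : Fin (n + 1) => (i : ℕ) ≤ k)) := by
        ext i; simp only [Finset.mem_filter, Finset.mem_univ, true_and, Finset.mem_insert,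
          Fin.ext_iff]; omega
      rw [this, Finset.sum_insert (by simp)]
      have h1 := ih (by omega)
      have h2 := h.2.1 ⟨k, by omega⟩ ⟨k + 1, hk⟩ rfl j hj
      linarith
  have h1 := key n (by omega)
  have h2 := le_makespan start (⟨n, by omega⟩ : Fin (n + 1)) hj
  have h3 : Finset.univ.filter (fun i : Fin (n + 1) => (i : ℕ) ≤ n) = Finset.univ := by
    ext i; simp; omega
  rw [h3] at h1
  exact h1.trans h2

/-! ### Upper bounds for earliest schedules, one group of machines at a time. -/

theorem exists_critical (hseq : ∀ i, IsOrderOf S (seq i)) (i : Fin m) {j : I.A} (hj : j ∈ S) :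
    ∃ u ∈ S, (seq i).idxOf u ≤ (seq i).idxOf j ∧
      I.ready seq (i + 1) j ≤ I.ready seq i u +
        ∑ k ∈ S with (seq i).idxOf u ≤ (seq i).idxOf k ∧ (seq i).idxOf k ≤ (seq i).idxOf j,
          I.p i k := by
  obtain ⟨u, hu, huj, h⟩ := seqStart_critical (r := I.ready seq i) (I.p_nonneg i)
    (seq i).idxOf (seq i) (fun k hk => ready_nonneg hseq i ((hseq i).mem_iff.1 hk))
    (pairwise_idxOf (hseq i).1) ((hseq i).mem_iff.2 hj)
  refine ⟨u, (hseq i).mem_iff.1 hu, huj, ?_⟩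
  rw [(hseq i).2] at h
  rwa [ready_succ]

theorem IsOrderOf.injOn {A : Type} [DecidableEq A] {S : Finset A} {l : List A}
    (h : IsOrderOf S l) : Set.InjOn l.idxOf S := fun _ hj _ _ hjk =>
  (List.idxOf_inj (h.mem_iff.2 hj)).1 hjk

variable {W X R : ℝ}

theorem ready_single_le (hseq : ∀ i, IsOrderOf S (seq i)) (i : Fin m)
    (hW : ∑ k ∈ S, I.p i k ≤ W) (hR : ∀ j ∈ S, I.ready seq i j ≤ R) {j : I.A} (hj : j ∈ S) :
    I.ready seq (i + 1) j ≤ R + W := by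
  obtain ⟨u, hu, -, h⟩ := exists_critical hseq i hj
  refine h.trans (add_le_add (hR u hu) (le_trans ?_ hW))
  exact Finset.sum_le_sum_of_subset_of_nonneg (Finset.filter_subset _ _)
    fun k _ _ => I.p_nonneg i k

/-- For the first machine of a group: `R` bounds all arrivals, so the critical block may be extended
to the start of the sequence. -/
theorem ready_first_le (hseq : ∀ i, IsOrderOf S (seq i)) (i : Fin m)
    (hR : ∀ j ∈ S, I.ready seq i j ≤ R) {j : I.A} (hj : j ∈ S) :
    I.ready seq (i + 1) j ≤
      R + ∑ k ∈ S with (seq i).idxOf k ≤ (seq i).idxOf j, I.p i k := by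
  obtain ⟨u, hu, -, h⟩ := exists_critical hseq i hj
  refine h.trans (add_le_add (hR u hu) ?_)
  refine Finset.sum_le_sum_of_subset_of_nonneg (fun k => ?_) fun k _ _ => I.p_nonneg i k
  simp only [Finset.mem_filter]
  tauto

/-- For the last machine of a group: the critical block may be extended to the end of the sequence.
-/
theorem exists_ready_last_le (hseq : ∀ i, IsOrderOf S (seq i)) (i : Fin m) {j : I.A} (hj : j ∈ S) :
    ∃ u ∈ S, I.ready seq (i + 1) j ≤
      I.ready seq i u + ∑ k ∈ S with (seq i).idxOf u ≤ (seq i).idxOf k, I.p i k := by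
  obtain ⟨u, hu, -, h⟩ := exists_critical hseq i hj
  refine ⟨u, hu, h.trans (add_le_add le_rfl ?_)⟩
  refine Finset.sum_le_sum_of_subset_of_nonneg (fun k => ?_) fun k _ _ => I.p_nonneg i k
  simp only [Finset.mem_filter]
  tauto

theorem ready_pair_le (hseq : ∀ i, IsOrderOf S (seq i)) (i₁ i₂ : Fin m) (h2 : (i₂ : ℕ) = i₁ + 1)
    (e2 : seq i₂ = seq i₁) (hJ : IsJohnsonOrder (I.p i₁) (I.p i₂) S (seq i₁))
    (hW : ∀ i, ∑ k ∈ S, I.p i k ≤ W) (hX : ∀ k ∈ S, ∑ i, I.p i k ≤ X)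
    (hR : ∀ j ∈ S, I.ready seq i₁ j ≤ R) {j : I.A} (hj : j ∈ S) :
    I.ready seq (i₂ + 1) j ≤ R + (W + X / 2) := by
  obtain ⟨u, hu, hlast⟩ := exists_ready_last_le hseq i₂ hj
  rw [e2, h2] at hlast
  have hfirst := ready_first_le hseq i₁ hR hu
  have hsum : I.p i₁ u + I.p i₂ u ≤ X := by
    refine le_trans ?_ (hX u hu)
    rw [← Finset.sum_pair (f := fun i => I.p i u) (by rintro rfl; omega)]
    exact Finset.sum_le_sum_of_subset_of_nonneg (Finset.subset_univ _)
      fun i _ _ => I.p_nonneg i u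
  have := two_machine_bound (hseq i₁).injOn hu (hJ.dichotomy u)
    (hW i₁) (hW i₂) hsum
  rw [h2]
  linarith

theorem ready_triple_le (hseq : ∀ i, IsOrderOf S (seq i)) (i₁ i₂ i₃ : Fin m)
    (h2 : (i₂ : ℕ) = i₁ + 1) (h3 : (i₃ : ℕ) = i₁ + 2)
    (e2 : seq i₂ = seq i₁) (e3 : seq i₃ = seq i₁)
    (hJ : IsRSOrder (I.p i₁) (I.p i₂) (I.p i₃) S (seq i₁))
    (hW : ∀ i, ∑ k ∈ S, I.p i k ≤ W) (hX : ∀ k ∈ S, ∑ i, I.p i k ≤ X)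
    (hR : ∀ j ∈ S, I.ready seq i₁ j ≤ R) {j : I.A} (hj : j ∈ S) :
    I.ready seq (i₃ + 1) j ≤ R + (W + max W X) := by
  obtain ⟨v, hv, hlast⟩ := exists_ready_last_le hseq i₃ hj
  obtain ⟨u, hu, huv, hmid⟩ := exists_critical hseq i₂ hv
  have hfirst := ready_first_le hseq i₁ hR hu
  rw [e3, h3] at hlast
  rw [e2] at huv
  rw [e2, h2] at hmid
  have hsum : I.p i₁ u + I.p i₂ u + I.p i₃ u ≤ X := by
    refine le_trans ?_ (hX u hu)
    have : ∑ i ∈ ({i₁, i₂, i₃} : Finset (Fin m)), I.p i u =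
        I.p i₁ u + I.p i₂ u + I.p i₃ u := by
      rw [Finset.sum_insert, Finset.sum_pair, add_assoc]
      · rintro rfl; omega
      · simp only [Finset.mem_insert, Finset.mem_singleton, Fin.ext_iff]; omega
    rw [← this]
    exact Finset.sum_le_sum_of_subset_of_nonneg (Finset.subset_univ _)
      fun i _ _ => I.p_nonneg i u
  -- The middle time occurs in both aggregated times and cancels.
  have hdich : (∀ k ∈ S, (seq i₁).idxOf k ≤ (seq i₁).idxOf u → I.p i₁ k ≤ I.p i₃ k) ∨
      (∀ k ∈ S, (seq i₁).idxOf u ≤ (seq i₁).idxOf k → I.p i₃ k ≤ I.p i₁ k) :=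
    (IsJohnsonOrder.dichotomy hJ u).imp
      (fun h k hk hku => by linarith [h k hk hku]) (fun h k hk hku => by linarith [h k hk hku])
  have := three_machine_bound (hseq i₁).injOn (I.p_nonneg i₁) (I.p_nonneg i₂) (I.p_nonneg i₃)
    hu huv hv hdich (hW i₁) (hW i₂) (hW i₃) hsum
  rw [h3]
  linarith

/-- Each triple contributes `2` to `ρ`, a single machine `1`, a pair `3 / 2`. -/
theorem rho_eq (m : ℕ) : rho m =
    2 * (m / 3 : ℕ) + if m % 3 = 0 then 0 else if m % 3 = 1 then 1 else 3 / 2 := by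
  have h : (m : ℝ) = 3 * (m / 3 : ℕ) + (m % 3 : ℕ) := by exact_mod_cast (Nat.div_add_mod m 3).symm
  have h3 := Nat.mod_lt m (show 3 > 0 by norm_num)
  unfold rho
  split_ifs with h0 h1
  · rw [h0] at h; rw [h]; push_cast; ring
  · rw [h1] at h; rw [h]; push_cast; ring
  · rw [show m % 3 = 2 by omega] at h; rw [h]; push_cast; ring

theorem rho_pos {m : ℕ} (hm : 0 < m) : 0 < rho m := by
  rw [rho_eq]
  split_ifs with h0 h1
  · have : 0 < m / 3 := by omega
    have : (0 : ℝ) < (m / 3 : ℕ) := by exact_mod_cast this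
    linarith
  · positivity
  · positivity

theorem ready_groups_le (hseq : I.IsSequencing S seq)
    (hW : ∀ i, ∑ k ∈ S, I.p i k ≤ W) (hX : ∀ k ∈ S, ∑ i, I.p i k ≤ X) (g : ℕ) (hg : 3 * g ≤ m) :
    ∀ j ∈ S, I.ready seq (3 * g) j ≤ g * (W + max W X) := by
  induction g with
  | zero => intro j _; simp [Inst.ready]
  | succ g ih =>
    intro j hj
    obtain ⟨e2, e3, hJ⟩ := hseq.2.1 g ⟨3 * g, by omega⟩ ⟨3 * g + 1, by omega⟩
      ⟨3 * g + 2, by omega⟩ rfl rfl rfl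
    have := ready_triple_le hseq.1 _ _ _ rfl rfl e2 e3 hJ hW hX (ih (by omega)) hj
    push_cast
    refine le_trans this (le_of_eq (by ring))

/-- With `X = C / ρ`, suppose `W < X`. The group bounds sum to `α W + β X` with `α + β = ρ` and `α >
0`, which is less than `ρ X = C`. -/
theorem makespan_earliest_le (hm : 0 < m) (hseq : I.IsSequencing S seq) (hW0 : 0 ≤ W)
    (hW : ∀ i, ∑ k ∈ S, I.p i k ≤ W)
    (hX : ∀ k ∈ S, ∑ i, I.p i k ≤ I.makespan S (I.earliest seq) / rho m) :
    I.makespan S (I.earliest seq) ≤ rho m * W := by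
  have hρ := rho_pos hm
  set C := I.makespan S (I.earliest seq) with hC
  set X := C / rho m with hXdef
  have hCX : C = rho m * X := by rw [hXdef]; field_simp
  rw [hCX]
  refine mul_le_mul_of_nonneg_left ?_ hρ.le
  by_contra! hlt
  have hX0 : 0 ≤ X := hW0.trans hlt.le
  have hgr := ready_groups_le hseq hW hX (m / 3) (by omega)
  rw [max_eq_right hlt.le] at hgr
  have fin_le : ∀ B, 0 ≤ B → (∀ j ∈ S, I.ready seq m j ≤ B) → C ≤ B := by
    intro B hB h
    refine makespan_le_iff.2 ⟨hB, fun i j hj => ?_⟩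
    rw [← ready_succ]
    exact (ready_mono hseq.1 hj (show (i : ℕ) + 1 ≤ m from i.2)).trans (h j hj)
  set k := m / 3 with hk
  have hρk := rho_eq m
  rw [← hk] at hρk
  rcases (by omega : m % 3 = 0 ∨ m % 3 = 1 ∨ m % 3 = 2) with h | h | h
  · have hkm : m = 3 * k := by omega
    have := fin_le (k * (W + X)) (by positivity) (by rwa [← hkm] at hgr)
    rw [hCX, hρk, if_pos h] at this
    have hk1 : (1 : ℝ) ≤ k := by exact_mod_cast (by omega : 1 ≤ k)
    nlinarith
  · have hkm : m = 3 * k + 1 := by omega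
    have := fin_le (k * (W + X) + W) (by positivity) (fun j hj => by
      have := ready_single_le hseq.1 ⟨3 * k, by omega⟩ (hW _) hgr hj
      simp only [← hkm] at this
      exact this)
    rw [hCX, hρk, if_neg (by omega), if_pos h] at this
    have hk1 : (0 : ℝ) ≤ k := by positivity
    nlinarith
  · have hkm : m = 3 * k + 2 := by omega
    obtain ⟨e2, hJ⟩ := hseq.2.2 h ⟨3 * k, by omega⟩ ⟨3 * k + 1, by omega⟩ hkm.symm hkm.symm
    have := fin_le (k * (W + X) + (W + X / 2)) (by positivity) (fun j hj => by
      have := ready_pair_le hseq.1 _ _ rfl e2 hJ hW hX hgr hj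
      simp only at this
      rwa [show 3 * k + 1 + 1 = m by omega] at this)
    rw [hCX, hρk, if_neg (by omega), if_neg (by omega)] at this
    have hk1 : (0 : ℝ) ≤ k := by positivity
    nlinarith

/-- Sequences of the required kind exist; on a single last machine the jobs may be sorted. -/
theorem exists_sequencing (I : Inst m) (S : Finset I.A) : ∃ seq, I.IsSequencing S seq ∧
    (m % 3 = 1 → ∀ i : Fin m, (i : ℕ) + 1 = m →
      (seq i).Pairwise (fun j k => I.p i j ≤ I.p i k)) := by
  have key : ∀ g : ℕ, ∃ l, IsOrderOf S l ∧
      (∀ i₁ i₂ i₃ : Fin m, (i₁ : ℕ) = 3 * g → (i₂ : ℕ) = 3 * g + 1 → (i₃ : ℕ) = 3 * g + 2 →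
        IsRSOrder (I.p i₁) (I.p i₂) (I.p i₃) S l) ∧
      (∀ i₁ i₂ : Fin m, (i₁ : ℕ) = 3 * g → (i₁ : ℕ) + 2 = m → (i₂ : ℕ) + 1 = m →
        IsJohnsonOrder (I.p i₁) (I.p i₂) S l) ∧
      (∀ i : Fin m, (i : ℕ) = 3 * g → (i : ℕ) + 1 = m →
        l.Pairwise (fun j k => I.p i j ≤ I.p i k)) := by
    intro g
    by_cases h : 3 * g + 2 < m
    · obtain ⟨l, hl⟩ := exists_johnsonOrder
        (fun j => I.p ⟨3 * g, by omega⟩ j + I.p ⟨3 * g + 1, by omega⟩ j)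
        (fun j => I.p ⟨3 * g + 1, by omega⟩ j + I.p ⟨3 * g + 2, h⟩ j) S
      refine ⟨l, hl.1, ?_, fun _ _ _ _ _ => by omega, fun _ _ _ => by omega⟩
      rintro ⟨i₁, _⟩ ⟨i₂, _⟩ ⟨i₃, _⟩ rfl rfl rfl
      exact hl
    · by_cases h' : 3 * g + 2 = m
      · obtain ⟨l, hl⟩ := exists_johnsonOrder (I.p ⟨3 * g, by omega⟩)
          (I.p ⟨3 * g + 1, by omega⟩) S
        refine ⟨l, hl.1, fun _ _ _ _ _ _ => by omega, ?_, fun _ _ _ => by omega⟩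
        rintro ⟨i₁, _⟩ ⟨i₂, _⟩ rfl _ h3
        obtain rfl : i₂ = 3 * g + 1 := by simp only at h3; omega
        exact hl
      · by_cases h'' : 3 * g + 1 = m
        · obtain ⟨l, hl, hs⟩ := exists_sorted_order (I.p ⟨3 * g, by omega⟩) S
          refine ⟨l, hl, fun _ _ _ _ _ _ => by omega, fun _ _ _ _ _ => by omega, ?_⟩
          rintro ⟨i, _⟩ rfl _
          exact hs
        -- No machine belongs to group `g`; any order will do.
        · obtain ⟨l, hl, hs⟩ := exists_sorted_order (fun _ => 0) S
          exact ⟨l, hl, fun _ _ _ _ _ _ => by omega, fun _ _ _ _ _ => by omega,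
            fun _ _ _ => by omega⟩
  choose L hL using key
  refine ⟨fun i => L (i / 3), ⟨fun i => (hL _).1, fun g i₁ i₂ i₃ h1 h2 h3 => ?_,
    fun hm i₁ i₂ h1 h2 => ?_⟩, fun hm i hi => (hL _).2.2.2 i (by omega) hi⟩
  · have e1 : (i₁ : ℕ) / 3 = g := by omega
    have e2 : (i₂ : ℕ) / 3 = g := by omega
    have e3 : (i₃ : ℕ) / 3 = g := by omega
    simp only [e1, e2, e3, true_and]
    exact (hL g).2.1 i₁ i₂ i₃ h1 h2 h3
  · have e2 : (i₂ : ℕ) / 3 = i₁ / 3 := by omega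
    simp only [e2, true_and]
    exact (hL _).2.2.1 i₁ i₂ (by omega) h1 h2

end Schedule

/-! ### Paths and path subroutines -/

section Paths

variable {m : ℕ} {I : Inst m} {ε : ℝ}

theorem IsPath.nodup {V A : Type} {src tgt : A → V} {u v : V} {l : List A}
    (h : IsPath src tgt u l v) : l.Nodup :=
  List.Nodup.of_map tgt (List.nodup_cons.1 h.2).2

theorem finite_setOf_isSTPath (I : Inst m) : {P | I.IsSTPath P}.Finite := by
  have : {l : List I.A | l.Nodup}.Finite :=
    Set.finite_coe_iff.1 (inferInstanceAs (Finite {l : List I.A // l.Nodup}))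
  exact this.subset fun P hP => IsPath.nodup hP

theorem exists_min_path (I : Inst m) (f : List I.A → ℝ) :
    ∃ P, I.IsSTPath P ∧ ∀ P', I.IsSTPath P' → f P ≤ f P' :=
  Set.exists_min_image _ f (finite_setOf_isSTPath I) I.exists_path

theorem card_add_one_le {P : List I.A} (hP : I.IsSTPath P) :
    P.toFinset.card + 1 ≤ Fintype.card I.V := by
  have h1 := List.Nodup.length_le_card hP.2
  have h2 := List.toFinset_card_le P
  simp only [List.length_cons, List.length_map] at h1
  omega

theorem exists_approxPath (hε : 0 < ε) (I : Inst m) (w : Fin m → I.A → ℝ) :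
    ∃ P, approxPath ε I w P := by
  obtain ⟨P, hP, hmin⟩ := exists_min_path I (I.maxWeight w)
  refine ⟨P, hP, fun P' hP' => (hmin P' hP').trans ?_⟩
  nlinarith [maxWeight_nonneg w P']

theorem exists_abv (I : Inst m) (w : Fin m → I.A → ℝ) : ∃ P, abv ε I w P := by
  obtain ⟨Q, hQ, hmin⟩ := exists_min_path I (I.avgWeight w)
  by_cases h : I.avgWeight w Q = 0
  · exact ⟨Q, Q, hQ, hmin, Or.inl ⟨h, rfl⟩⟩
  · obtain ⟨P, hP, hminP⟩ := exists_min_path I (I.maxWeight (fun i a =>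
            (⌊(Fintype.card I.V : ℝ) * w i a / (ε * I.avgWeight w Q)⌋ : ℝ)))
    exact ⟨P, Q, hQ, hmin, Or.inr ⟨h, hP, hminP⟩⟩

theorem avgWeight_le_maxWeight (hm : 0 < m) (w : Fin m → I.A → ℝ) (P : List I.A) :
    I.avgWeight w P ≤ I.maxWeight w P := by
  have hm' : (0 : ℝ) < m := by exact_mod_cast hm
  rw [Inst.avgWeight, div_le_iff₀ hm']
  calc ∑ i, ∑ a ∈ P.toFinset, w i a ≤ ∑ _i : Fin m, I.maxWeight w P :=
        Finset.sum_le_sum fun i _ => le_maxWeight w P i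
    _ = I.maxWeight w P * m := by simp [mul_comm]

/-- The scaling scheme of Aissi, Bazgan and Vanderpooten is `(1+ε)`-approximate. -/
theorem approxPath_of_abv (hm : 0 < m) (hε : 0 < ε) {w : Fin m → I.A → ℝ}
    (hw : ∀ i a, 0 ≤ w i a) {P : List I.A} (h : abv ε I w P) : approxPath ε I w P := by
  obtain ⟨Q, hQ, hmin, ⟨h0, rfl⟩ | ⟨h0, hP, hminP⟩⟩ := h
  · refine ⟨hQ, fun P' _ => ?_⟩
    have hm' : (m : ℝ) ≠ 0 := by exact_mod_cast hm.ne'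
    have hsum : ∀ i, 0 ≤ ∑ a ∈ P.toFinset, w i a := fun i =>
      Finset.sum_nonneg fun a _ => hw i a
    rw [Inst.avgWeight, div_eq_zero_iff, or_iff_left hm',
      Finset.sum_eq_zero_iff_of_nonneg fun i _ => hsum i] at h0
    have hP' : 0 ≤ (1 + ε) * I.maxWeight w P' :=
      mul_nonneg (by linarith) (maxWeight_nonneg w P')
    exact maxWeight_le_iff.2 ⟨hP', fun i => by rw [h0 i (Finset.mem_univ i)]; exact hP'⟩
  · refine ⟨hP, fun P' hP' => ?_⟩
    set L := I.avgWeight w Q with hL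
    have hLpos : 0 < L := lt_of_le_of_ne
      (div_nonneg (Finset.sum_nonneg fun i _ => Finset.sum_nonneg fun a _ => hw i a)
        (Nat.cast_nonneg m)) (Ne.symm h0)
    set n : ℝ := (Fintype.card I.V : ℝ) with hn
    have hcard := card_add_one_le hP
    have hn0 : 0 < n := by
      rw [hn]; exact_mod_cast (by omega : 0 < Fintype.card I.V)
    have hεL : 0 < ε * L := mul_pos hε hLpos
    set f : Fin m → I.A → ℝ := fun i a => (⌊n * w i a / (ε * L)⌋ : ℝ) with hf
    have hlow : ∀ i a, f i a * (ε * L) ≤ n * w i a := fun i a => by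
      rw [← le_div_iff₀ hεL]; exact Int.floor_le _
    have hupp : ∀ i a, n * w i a ≤ f i a * (ε * L) + ε * L := fun i a => by
      have : n * w i a / (ε * L) ≤ f i a + 1 := (Int.lt_floor_add_one _).le
      rw [div_le_iff₀ hεL] at this
      linarith
    have hLP' : L ≤ I.maxWeight w P' := (hmin P' hP').trans (avgWeight_le_maxWeight hm w P')
    have hfP' : I.maxWeight f P' * (ε * L) ≤ n * I.maxWeight w P' := by
      rw [← le_div_iff₀ hεL]
      refine maxWeight_le_iff.2 ⟨div_nonneg (mul_nonneg hn0.le (maxWeight_nonneg w P')) hεL.le,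
        fun i => ?_⟩
      rw [le_div_iff₀ hεL, Finset.sum_mul]
      calc ∑ a ∈ P'.toFinset, f i a * (ε * L) ≤ ∑ a ∈ P'.toFinset, n * w i a :=
            Finset.sum_le_sum fun a _ => hlow i a
        _ = n * ∑ a ∈ P'.toFinset, w i a := (Finset.mul_sum _ _ _).symm
        _ ≤ _ := mul_le_mul_of_nonneg_left (le_maxWeight w P' i) hn0.le
    have hpos : 0 ≤ (1 + ε) * I.maxWeight w P' :=
      mul_nonneg (by linarith) (maxWeight_nonneg w P')
    refine maxWeight_le_iff.2 ⟨hpos, fun i => ?_⟩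
    refine le_of_mul_le_mul_left ?_ hn0
    have hcard' : (P.toFinset.card : ℝ) ≤ n := by
      rw [hn]; exact_mod_cast (by omega : P.toFinset.card ≤ Fintype.card I.V)
    -- After scaling by `n`, rounding loses at most `ε * L` on each of at most `n` arcs, and `L` is
    -- a lower bound for the weight of `P'`.
    calc n * ∑ a ∈ P.toFinset, w i a = ∑ a ∈ P.toFinset, n * w i a := Finset.mul_sum _ _ _
      _ ≤ ∑ a ∈ P.toFinset, (f i a * (ε * L) + ε * L) := Finset.sum_le_sum fun a _ => hupp i a
      _ = (∑ a ∈ P.toFinset, f i a) * (ε * L) + P.toFinset.card * (ε * L) := by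
          rw [Finset.sum_add_distrib, Finset.sum_mul]; simp
      _ ≤ I.maxWeight f P' * (ε * L) + n * (ε * L) := by
          gcongr
          exact (le_maxWeight f P i).trans (hminP P' hP')
      _ ≤ n * I.maxWeight w P' + n * (ε * I.maxWeight w P') := by
          gcongr
      _ = n * ((1 + ε) * I.maxWeight w P') := by ring

end Paths

/-! ### Executions of the algorithm -/

section Algorithm

variable {m : ℕ} {I : Inst m} {ε : ℝ} {sub : Subroutine m}

theorem bigM_nonneg (hε : 0 < ε) (I : Inst m) : 0 ≤ I.bigM ε := by
  have : 0 ≤ ∑ j, ∑ i, I.p i j :=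
    Finset.sum_nonneg fun j _ => Finset.sum_nonneg fun i _ => I.p_nonneg i j
  have : 0 ≤ (1 + ε) * ∑ j, ∑ i, I.p i j := mul_nonneg (by linarith) this
  unfold Inst.bigM
  linarith

theorem weights_nonneg (hε : 0 < ε) (I : Inst m) (D : Finset I.A) (i : Fin m) (a : I.A) :
    0 ≤ I.weights ε D i a := by
  unfold Inst.weights
  split_ifs
  · exact bigM_nonneg hε I
  · exact I.p_nonneg i a

/-- The reason for the choice of `M`: if some path avoids all marked arcs, then no path through a
marked arc is `(1 + ε)`-approximate. -/
theorem maxWeight_p_lt_bigM (hε : 0 < ε) (P : List I.A) :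
    (1 + ε) * I.maxWeight I.p P < I.bigM ε := by
  have h : I.maxWeight I.p P ≤ ∑ j, ∑ i, I.p i j := by
    refine maxWeight_le_iff.2 ⟨Finset.sum_nonneg fun j _ => Finset.sum_nonneg fun i _ =>
      I.p_nonneg i j, fun i => ?_⟩
    calc ∑ j ∈ P.toFinset, I.p i j ≤ ∑ j, I.p i j :=
          Finset.sum_le_sum_of_subset_of_nonneg (Finset.subset_univ _)
            fun j _ _ => I.p_nonneg i j
      _ ≤ ∑ j, ∑ i, I.p i j := Finset.sum_le_sum fun j _ =>
          Finset.single_le_sum (f := fun i => I.p i j) (fun i _ => I.p_nonneg i j)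
            (Finset.mem_univ i)
  have := mul_le_mul_of_nonneg_left h (show 0 ≤ 1 + ε by linarith)
  unfold Inst.bigM
  linarith

theorem maxWeight_weights_of_disjoint {D : Finset I.A} {P : List I.A}
    (h : Disjoint P.toFinset D) : I.maxWeight (I.weights ε D) P = I.maxWeight I.p P := by
  unfold Inst.maxWeight
  congr 1
  funext i
  refine Finset.sum_congr rfl fun a ha => ?_
  simp [Inst.weights, Finset.disjoint_left.1 h ha]

theorem bigM_le_maxWeight (hm : 0 < m) (hε : 0 < ε) {D : Finset I.A} {P : List I.A} {j : I.A}
    (hj : j ∈ P.toFinset) (hD : j ∈ D) : I.bigM ε ≤ I.maxWeight (I.weights ε D) P := by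
  refine le_trans ?_ (le_maxWeight (I.weights ε D) P ⟨0, hm⟩)
  refine le_trans (le_of_eq ?_) (Finset.single_le_sum
    (f := I.weights ε D ⟨0, hm⟩) (fun a _ => weights_nonneg hε I D _ a) hj)
  simp [Inst.weights, hD]

theorem IsCurrent.feasible (hsub : ∀ D P, sub I (I.weights ε D) P → I.IsSTPath P)
    {D : Finset I.A} {x : Sol I} (h : IsCurrent sub ε I D x) : x.Feasible := by
  obtain ⟨h1, seq, h2, h3⟩ := h
  refine ⟨hsub D _ h1, ?_⟩
  rw [h3]
  exact isSchedule_earliest h2.1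

theorem exists_isCurrent (hsub : ∀ w, ∃ P, sub I w P) (D : Finset I.A) :
    ∃ x, IsCurrent sub ε I D x := by
  obtain ⟨P, hP⟩ := hsub (I.weights ε D)
  obtain ⟨seq, hseq, -⟩ := exists_sequencing I P.toFinset
  exact ⟨⟨P, I.earliest seq⟩, hP, seq, hseq, rfl⟩

theorem exists_isStep (hsub : ∀ w, ∃ P, sub I w P) {σ : State I} (hσ : σ.Guard) :
    ∃ τ, IsStep sub ε I σ τ := by
  classical
  obtain ⟨x, hx⟩ := exists_isCurrent (ε := ε) hsub
    (σ.marked ∪ Finset.univ.filter fun j => σ.Large j)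
  by_cases h : x.cmax < σ.best.cmax
  · exact ⟨⟨x, x, _⟩, hσ, by simp, hx, Or.inl ⟨h, rfl⟩⟩
  · exact ⟨⟨x, σ.best, _⟩, hσ, by simp, hx, Or.inr ⟨not_lt.1 h, rfl⟩⟩

/-- The large job on the current path that keeps the loop running is unmarked, and the pass marks
it. -/
theorem Reaches.le_card_marked {k : ℕ} {σ : State I} (h : Reaches sub ε I k σ) :
    k ≤ σ.marked.card := by
  induction h with
  | init σ _ => exact Nat.zero_le _
  | step k σ τ _ hst ih =>
    obtain ⟨⟨hd, j, hj, hl⟩, hm, -⟩ := hst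
    have : σ.marked ⊂ τ.marked := by
      refine (Finset.ssubset_iff_of_subset fun j hj => (hm j).2 (Or.inl hj)).2
        ⟨j, (hm j).2 (Or.inr hl), Finset.disjoint_left.1 hd hj⟩
    have := Finset.card_lt_card this
    omega

theorem Reaches.le_card {k : ℕ} {σ : State I} (h : Reaches sub ε I k σ) :
    k ≤ Fintype.card I.A :=
  h.le_card_marked.trans (Finset.card_le_univ _)

theorem exists_returns (hsub : ∀ w, ∃ P, sub I w P) : ∃ x, Returns sub ε I x := by
  by_contra hno
  have hguard : ∀ k σ, Reaches sub ε I k σ → σ.Guard := fun k σ h => by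
    by_contra hg
    exact hno ⟨_, k, σ, h, hg, rfl⟩
  have key : ∀ k, ∃ σ, Reaches sub ε I k σ := by
    intro k
    induction k with
    | zero =>
      obtain ⟨x, hx⟩ := exists_isCurrent (ε := ε) hsub (∅ : Finset I.A)
      exact ⟨⟨x, x, ∅⟩, .init _ ⟨rfl, hx, rfl⟩⟩
    | succ k ih =>
      obtain ⟨σ, hσ⟩ := ih
      obtain ⟨τ, hτ⟩ := exists_isStep hsub (hguard k σ hσ)
      exact ⟨τ, .step k σ τ hσ hτ⟩
  obtain ⟨σ, hσ⟩ := key (Fintype.card I.A + 1)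
  have := hσ.le_card
  omega

/-- Jobs were marked relative to earlier current makespans. The best makespan is no larger than any
of these, so comparing with it makes the history unnecessary. -/
theorem Reaches.invariant (hm : 0 < m) (hsub : ∀ D P, sub I (I.weights ε D) P → I.IsSTPath P)
    {k : ℕ} {σ : State I} (h : Reaches sub ε I k σ) :
    (∀ j ∈ σ.marked, σ.best.cmax / rho m < ∑ i, I.p i j) ∧ σ.best.cmax ≤ σ.cur.cmax ∧
      IsCurrent sub ε I σ.marked σ.cur ∧ σ.best.Feasible := by
  have hρ := rho_pos hm
  induction h with
  | init σ hi =>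
    obtain ⟨h1, h2, h3⟩ := hi
    rw [h1, h3]
    exact ⟨by simp, le_rfl, h2, h2.feasible hsub⟩
  | step k σ τ _ hst ih =>
    obtain ⟨i1, i2, i3, i4⟩ := ih
    obtain ⟨-, hmk, hcur, hbest⟩ := hst
    have hle : τ.best.cmax ≤ σ.best.cmax := by
      rcases hbest with ⟨h, e⟩ | ⟨h, e⟩ <;> rw [e]
      exact h.le
    refine ⟨fun j hj => ?_, ?_, hcur, ?_⟩
    · rcases (hmk j).1 hj with h | h
      · exact (div_le_div_of_nonneg_right hle hρ.le).trans_lt (i1 j h)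
      · exact (div_le_div_of_nonneg_right (hle.trans i2) hρ.le).trans_lt h
    · rcases hbest with ⟨h, e⟩ | ⟨h, e⟩ <;> rw [e]
      exact h
    · rcases hbest with ⟨h, e⟩ | ⟨h, e⟩ <;> rw [e]
      · exact hcur.feasible hsub
      · exact i4

theorem Returns.feasible_and_le (hm : 0 < m) (hε : 0 < ε)
    (hsub : ∀ D P, sub I (I.weights ε D) P → approxPath ε I (I.weights ε D) P) {x : Sol I}
    (hx : Returns sub ε I x) :
    x.Feasible ∧ x.cmax ≤ (1 + ε) * rho m * I.opt := by
  obtain ⟨k, σ, hσ, hguard, rfl⟩ := hx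
  obtain ⟨hmark, hle, hcur, hfeas⟩ := hσ.invariant hm fun D P h => (hsub D P h).1
  refine ⟨hfeas, ?_⟩
  have hρ := rho_pos hm
  have hpos : 0 < (1 + ε) * rho m := mul_pos (by linarith) hρ
  rw [← div_le_iff₀' hpos]
  refine le_csInf ⟨_, σ.best, hfeas, rfl⟩ ?_
  rintro c ⟨y, hy, rfl⟩
  rw [div_le_iff₀' hpos]
  have hy0 : 0 ≤ y.cmax := makespan_nonneg _
  -- `y` is an arbitrary feasible solution, so it need not be known that the optimum is attained.
  by_cases hd : Disjoint y.jobs σ.marked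
  · obtain ⟨hsubcur, seq, hseq, hstart⟩ := hcur
    have happ := (hsub _ _ hsubcur).2 y.path hy.1
    rw [maxWeight_weights_of_disjoint hd] at happ
    have hdc : Disjoint σ.cur.jobs σ.marked := by
      rw [Finset.disjoint_left]
      intro j hj hj'
      have h1 := bigM_le_maxWeight hm hε hj hj'
      have h2 := maxWeight_p_lt_bigM hε y.path
      linarith
    rw [maxWeight_weights_of_disjoint hdc] at happ
    -- The path has no marked job, so the guard can only fail for lack of a large one.
    have hX : ∀ j ∈ σ.cur.jobs, ∑ i, I.p i j ≤ σ.cur.cmax / rho m := fun j hj => by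
      by_contra! h
      exact hguard ⟨hdc, j, hj, h⟩
    have hbound : σ.cur.cmax ≤ rho m * I.maxWeight I.p σ.cur.path := by
      unfold Sol.cmax at hX ⊢
      rw [hstart] at hX ⊢
      exact makespan_earliest_le hm hseq (maxWeight_nonneg _ _)
        (fun i => le_maxWeight I.p σ.cur.path i) hX
    calc σ.best.cmax ≤ rho m * I.maxWeight I.p σ.cur.path := hle.trans hbound
      _ ≤ rho m * ((1 + ε) * y.cmax) := by
        refine mul_le_mul_of_nonneg_left (happ.trans ?_) hρ.le
        exact mul_le_mul_of_nonneg_left (maxWeight_le_cmax hy) (by linarith)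
      _ = (1 + ε) * rho m * y.cmax := by ring
  · obtain ⟨j, hj, hj'⟩ := Finset.not_disjoint_iff.1 hd
    have h1 := (hmark j hj').trans_le (sum_machines_le_makespan hy.2 hj)
    rw [div_lt_iff₀ hρ] at h1
    have h2 : 0 ≤ ε * (rho m * y.cmax) := mul_nonneg hε.le (mul_nonneg hρ.le hy0)
    change σ.best.cmax < y.cmax * rho m at h1
    linarith

end Algorithm

end FlowShopPath

namespace FlowShopPath

/-! ### Worst-case instances -/

/-- The processing times of a job set on which the path schedule has makespan `ρ`, while every
machine has load `1` and every job has total processing time at most `1`. Only the jobs `3g`,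
`3g + 1`, `3g + 2` have work on the group of machines that starts with `3g`. -/
noncomputable def tightTime (m i j : ℕ) : ℝ :=
  if i / 3 ≠ j / 3 then 0
  else if i % 3 = 1 ∧ i + 1 ≠ m then (if j % 3 = 2 then 1 else 0)
  else (if j % 3 = 2 then 0 else 1 / 2)

theorem tightTime_nonneg (m i j : ℕ) : 0 ≤ tightTime m i j := by
  unfold tightTime
  split_ifs <;> norm_num

theorem sum_eq_three {N g : ℕ} {f : ℕ → ℝ} (hN : 3 * g + 2 < N)
    (hf : ∀ k, k / 3 ≠ g → f k = 0) :
    ∑ k ∈ Finset.range N, f k = f (3 * g) + f (3 * g + 1) + f (3 * g + 2) := by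
  have h : ∑ k ∈ ({3 * g, 3 * g + 1, 3 * g + 2} : Finset ℕ), f k =
      ∑ k ∈ Finset.range N, f k := by
    refine Finset.sum_subset (fun k hk => ?_) fun k _ hk => hf k fun hkg => hk ?_
    · simp only [Finset.mem_insert, Finset.mem_singleton] at hk
      rw [Finset.mem_range]
      omega
    · simp only [Finset.mem_insert, Finset.mem_singleton]
      omega
  rw [← h, Finset.sum_insert (by simp), Finset.sum_pair (by simp), add_assoc]

theorem sum_tightTime_jobs {m i : ℕ} (hi : i < m) :
    ∑ j : Fin (m + 4), tightTime m i j = 1 := by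
  rw [Fin.sum_univ_eq_sum_range (fun j => tightTime m i j) (m + 4),
    sum_eq_three (g := i / 3) (by omega) (fun k hk => by simp [tightTime, Ne.symm hk])]
  have h0 : (3 * (i / 3)) / 3 = i / 3 := by omega
  have h1 : (3 * (i / 3) + 1) / 3 = i / 3 := by omega
  have h2 : (3 * (i / 3) + 2) / 3 = i / 3 := by omega
  have k0 : (3 * (i / 3)) % 3 = 0 := by omega
  have k1 : (3 * (i / 3) + 1) % 3 = 1 := by omega
  have k2 : (3 * (i / 3) + 2) % 3 = 2 := by omega
  simp only [tightTime, h0, h1, h2, k0, k1, k2]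
  split_ifs <;> simp_all; norm_num

theorem sum_tightTime_machines (m j : ℕ) : ∑ i : Fin m, tightTime m i j ≤ 1 := by
  rw [Fin.sum_univ_eq_sum_range (fun i => tightTime m i j) m]
  -- Padding with zeros completes the last group of machines, or the group of a job that has no
  -- machines.
  have h : ∑ i ∈ Finset.range m, tightTime m i j =
      ∑ i ∈ Finset.range (m + 3 * (j / 3) + 3), if i < m then tightTime m i j else 0 := by
    rw [← Finset.sum_filter]
    congr 1
    ext i
    simp only [Finset.mem_range, Finset.mem_filter]
    omega
  rw [h, sum_eq_three (g := j / 3) (by omega) (fun k hk => by simp [tightTime, hk])]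
  have h0 : (3 * (j / 3)) / 3 = j / 3 := by omega
  have h1 : (3 * (j / 3) + 1) / 3 = j / 3 := by omega
  have h2 : (3 * (j / 3) + 2) / 3 = j / 3 := by omega
  have k0 : (3 * (j / 3)) % 3 = 0 := by omega
  have k1 : (3 * (j / 3) + 1) % 3 = 1 := by omega
  have k2 : (3 * (j / 3) + 2) % 3 = 2 := by omega
  have e0 : ¬ (0 = 1) := by norm_num
  have e2 : ¬ (2 = 1) := by norm_num
  simp only [tightTime, h0, h1, h2, k0, k1, k2, e0, e2, false_and, true_and, if_false, ne_eq,
    not_true_eq_false]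
  split_ifs <;> first | omega | norm_num

/-- A long path with the jobs of `tightTime`, and a direct arc with work `β` on the first
machine. -/
noncomputable abbrev tightInst (m : ℕ) (β : ℝ) (hβ : 0 ≤ β) : Inst m where
  V := Fin (m + 5)
  -- `none` is the direct arc. There is room for the three jobs of every group, even an incomplete
  -- one, and for job `3 * (m / 3) + 3`, which has no work at all.
  A := Option (Fin (m + 4))
  src a := a.elim 0 Fin.castSucc
  tgt a := a.elim (Fin.last _) Fin.succ
  s := 0
  t := Fin.last _
  s_ne_t := (Fin.last_pos).ne
  exists_path := ⟨[none], ⟨rfl, rfl⟩, by simp [Fin.ext_iff]⟩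
  p i a := a.elim (if (i : ℕ) = 0 then β else 0) fun j => tightTime m i j
  p_nonneg i a := by
    cases a with
    | none => simp only [Option.elim]; split_ifs <;> simp [hβ]
    | some j => exact tightTime_nonneg _ _ _

section Tight

variable {m : ℕ} {β : ℝ} {hβ : 0 ≤ β}

/-- Without the direct arc, a walk advances one vertex at a time and skips no arc. -/
theorem tightInst_path_dichotomy_aux (l : List (Option (Fin (m + 4)))) (k : Fin (m + 5))
    (h : IsWalk (tightInst m β hβ).src (tightInst m β hβ).tgt k l (Fin.last _)) :
    none ∈ l ∨ ∀ j : Fin (m + 4), k ≤ j.castSucc → some j ∈ l := by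
  induction l generalizing k with
  | nil =>
    right
    intro j hj
    change k = Fin.last _ at h
    subst h
    exact absurd (Fin.castSucc_lt_last j) (not_lt.2 hj)
  | cons a l ih =>
    obtain ⟨h1, h2⟩ := h
    cases a with
    | none => simp
    | some i =>
      change i.castSucc = k at h1
      subst h1
      rcases ih _ h2 with h | h
      · left; simp [h]
      · right
        intro j hj
        by_cases hji : j = i
        · simp [hji]
        · refine List.mem_cons_of_mem _ (h j ?_)
          change i.succ ≤ j.castSucc
          have : (i : ℕ) ≤ j := hj
          have : (j : ℕ) ≠ i := fun h => hji (Fin.ext h)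
          rw [Fin.le_def]
          simp only [Fin.val_succ, Fin.val_castSucc]
          omega

theorem tightInst_path_dichotomy {P : List (Option (Fin (m + 4)))}
    (h : (tightInst m β hβ).IsSTPath P) :
    none ∈ P ∨ ∀ j : Fin (m + 4), some j ∈ P :=
  (tightInst_path_dichotomy_aux P 0 h.1).imp id fun h j => h j (Fin.zero_le _)

theorem exists_tightInst_path (m : ℕ) (β : ℝ) (hβ : 0 ≤ β) :
    ∃ P : List (Option (Fin (m + 4))), (tightInst m β hβ).IsSTPath P ∧
      P.toFinset = Finset.univ.map Function.Embedding.some := by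
  have key : ∀ d : ℕ, ∀ k : Fin (m + 5), (k : ℕ) + d = m + 4 → ∃ l : List (Fin (m + 4)),
      IsWalk (tightInst m β hβ).src (tightInst m β hβ).tgt k (l.map some) (Fin.last _) ∧
      (∀ j, j ∈ l ↔ (k : ℕ) ≤ j) ∧ l.Nodup := by
    intro d
    induction d with
    | zero =>
      intro k hk
      refine ⟨[], Fin.ext hk, fun j => ?_, List.nodup_nil⟩
      simp only [List.not_mem_nil, false_iff]
      omega
    | succ d ih =>
      intro k hk
      have hkl : (k : ℕ) < m + 4 := by omega
      obtain ⟨l, h1, h2, h3⟩ := ih (⟨k, hkl⟩ : Fin (m + 4)).succ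
        (by simp only [Fin.val_succ]; omega)
      refine ⟨⟨k, hkl⟩ :: l, ⟨rfl, h1⟩, fun j => ?_, List.nodup_cons.2 ⟨?_, h3⟩⟩
      · simp only [List.mem_cons, h2, Fin.val_succ, Fin.ext_iff]
        omega
      · simp [h2]
  obtain ⟨l, h1, h2, h3⟩ := key (m + 4) 0 (by simp)
  refine ⟨l.map some, ⟨h1, ?_⟩, ?_⟩
  · rw [List.map_map, List.nodup_cons]
    refine ⟨?_, h3.map (Fin.succ_injective _)⟩
    intro h
    obtain ⟨j, -, hj⟩ := List.mem_map.1 h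
    exact Fin.succ_ne_zero j hj
  · ext a
    cases a <;> simp [h2]

/-- Every path has load at least `β` on the first machine. -/
theorem le_load_first (hm : 0 < m) (hβ1 : β ≤ 1) {P : List (Option (Fin (m + 4)))}
    (h : (tightInst m β hβ).IsSTPath P) :
    β ≤ ∑ a ∈ P.toFinset, (tightInst m β hβ).p ⟨0, hm⟩ a := by
  rcases tightInst_path_dichotomy h with h | h
  · have := Finset.single_le_sum (f := (tightInst m β hβ).p ⟨0, hm⟩)
      (fun a _ => (tightInst m β hβ).p_nonneg _ a) (List.mem_toFinset.2 h)
    simpa using this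
  · have hsub : Finset.univ.map Function.Embedding.some ⊆ P.toFinset := by
      intro a ha
      obtain ⟨j, -, rfl⟩ := Finset.mem_map.1 ha
      exact List.mem_toFinset.2 (h j)
    refine hβ1.trans ((sum_tightTime_jobs hm).symm.le.trans ?_)
    refine le_trans (le_of_eq ?_) (Finset.sum_le_sum_of_subset_of_nonneg hsub
      fun a _ _ => (tightInst m β hβ).p_nonneg _ a)
    rw [Finset.sum_map]
    rfl

theorem opt_tightInst_le : (tightInst m β hβ).opt ≤ β := by
  have hpath : (tightInst m β hβ).IsSTPath [none] := ⟨⟨rfl, rfl⟩, by simp [Fin.ext_iff]⟩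
  let x : Sol (tightInst m β hβ) := ⟨[none], fun i _ => if (i : ℕ) = 0 then 0 else β⟩
  have hjobs : ∀ j ∈ x.jobs, j = none := fun j hj => by simpa [x, Sol.jobs] using hj
  have hx : x.Feasible := by
    refine ⟨hpath, fun i j hj => ?_, fun i i' hi j hj => ?_, fun i j hj j' hj' hne => ?_⟩
    · simp only [x]; split_ifs <;> simp [hβ]
    · obtain rfl := hjobs j hj
      simp only [x, Option.elim]
      rw [if_neg (by omega : ¬ (i' : ℕ) = 0)]
      split_ifs <;> simp
    · exact absurd ((hjobs j hj).trans (hjobs j' hj').symm) hne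
  have hc : x.cmax ≤ β := by
    refine makespan_le_iff.2 ⟨hβ, fun i j hj => ?_⟩
    obtain rfl := hjobs j hj
    simp only [x, Option.elim]
    split_ifs <;> simp
  refine le_trans ?_ hc
  unfold Inst.opt
  refine csInf_le ⟨0, ?_⟩ ⟨x, hx, rfl⟩
  rintro c ⟨y, -, rfl⟩
  exact makespan_nonneg _

theorem le_opt_tightInst (hm : 0 < m) (hβ1 : β ≤ 1) : β ≤ (tightInst m β hβ).opt := by
  obtain ⟨P, hP⟩ := (tightInst m β hβ).exists_path
  obtain ⟨seq, hseq, -⟩ := exists_sequencing (tightInst m β hβ) P.toFinset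
  unfold Inst.opt
  refine le_csInf ⟨_, (⟨P, (tightInst m β hβ).earliest seq⟩ : Sol _),
    ⟨hP, isSchedule_earliest hseq.1⟩, rfl⟩ ?_
  rintro c ⟨y, hy, rfl⟩
  exact (le_load_first hm hβ1 hy.1).trans (sum_jobs_le_makespan hy.2 _)

end Tight

/-! ### The schedule of the worst-case instances -/

/-- A job `z` that precedes two jobs of length `1 / 2` delays one of them. -/
theorem exists_delayed {m : ℕ} {I : Inst m} {S : Finset I.A} {seq : Fin m → List I.A}
    (hseq : ∀ i, IsOrderOf S (seq i)) {i : Fin m} {κ : I.A → ℝ}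
    (hκ : (seq i).Pairwise (fun j k => κ j ≤ κ k)) {z v w : I.A} (hz : z ∈ S) (hv : v ∈ S)
    (hw : w ∈ S) (hvw : v ≠ w) (hzv : κ z < κ v) (hzw : κ z < κ w)
    (pv : I.p i v = 1 / 2) (pw : I.p i w = 1 / 2) {R : ℝ} (hR : R ≤ I.ready seq i z) :
    ∃ x, (x = v ∨ x = w) ∧ R + 1 / 2 ≤ I.earliest seq i x := by
  have hbefore : ∀ x ∈ S, κ z < κ x → R ≤ I.earliest seq i x := fun x hx hzx => by
    have h1 := seqStart_add_le (r := I.ready seq i) (I.p_nonneg i) 0 _ hκ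
      ((hseq i).mem_iff.2 hz) ((hseq i).mem_iff.2 hx) (by rintro rfl; exact lt_irrefl _ hzx)
      (not_le.2 hzx)
    have h2 := ready_le_earliest hseq i hz
    have h3 := I.p_nonneg i z
    change I.earliest seq i z + _ ≤ I.earliest seq i x at h1
    linarith
  rcases (isSchedule_earliest hseq).2.2 i v hv w hw hvw with h | h
  · exact ⟨w, Or.inr rfl, by linarith [hbefore v hv hzv]⟩
  · exact ⟨v, Or.inl rfl, by linarith [hbefore w hw hzw]⟩

section TightSchedule

variable {m : ℕ} {β : ℝ} {hβ : 0 ≤ β} {S : Finset (Option (Fin (m + 4)))}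
  {seq : Fin m → List (Option (Fin (m + 4)))}

/-- On a triple, jobs `v`, `w` have times `1/2, 0, 1/2` and `u` has `0, 1, 0`, so the RS keys are
`1/2`, `1/2`, `1`. The late job `z` has no work there, hence key `0`, and comes first. One of `v`,
`w` then ends on the first machine at `2g + 1` or later, and `u`, sequenced behind it, leaves the
middle machine at `2g + 2` or later. Thus `u` is the late job for the next triple; the condition on
`z / 3` says that `z` has no work from group `g` on. -/
theorem tight_group (hS : S = Finset.univ.map Function.Embedding.some)
    (hseq : (tightInst m β hβ).IsSequencing S seq) (g : ℕ) (hg : 3 * g ≤ m) :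
    ∃ z : Fin (m + 4), ((z : ℕ) / 3 < g ∨ m / 3 < (z : ℕ) / 3) ∧
      2 * (g : ℝ) ≤ (tightInst m β hβ).ready seq (3 * g) (some z) := by
  have hmem : ∀ j : Fin (m + 4), some j ∈ S := fun j => by simp [hS]
  induction g with
  | zero =>
    -- The job without any work plays the late job of the first group.
    exact ⟨⟨3 * (m / 3) + 3, by omega⟩, Or.inr (by simp only; omega), by simp [Inst.ready]⟩
  | succ g ih =>
    obtain ⟨z, hz, hR⟩ := ih (by omega)
    have hzg : g ≠ (z : ℕ) / 3 := by omega
    let i₁ : Fin m := ⟨3 * g, by omega⟩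
    let i₂ : Fin m := ⟨3 * g + 1, by omega⟩
    let i₃ : Fin m := ⟨3 * g + 2, by omega⟩
    let v : Fin (m + 4) := ⟨3 * g, by omega⟩
    let w : Fin (m + 4) := ⟨3 * g + 1, by omega⟩
    let u : Fin (m + 4) := ⟨3 * g + 2, by omega⟩
    obtain ⟨-, -, hJ⟩ := hseq.2.1 g i₁ i₂ i₃ rfl rfl rfl
    have d0 : 3 * g / 3 = g := by omega
    have d1 : (3 * g + 1) / 3 = g := by omega
    have d2 : (3 * g + 2) / 3 = g := by omega
    have r0 : 3 * g % 3 = 0 := by omega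
    have r1 : (3 * g + 1) % 3 = 1 := by omega
    have r2 : (3 * g + 2) % 3 = 2 := by omega
    have hlast : 3 * g + 1 + 1 ≠ m := by omega
    have hκ := IsJohnsonOrder.pairwise_of_eq (fun j hj => by
      rw [hS, Finset.mem_map] at hj
      obtain ⟨j, -, rfl⟩ := hj
      simp only [i₁, i₂, i₃, tightTime, d0, d1, d2, r0, r2, Option.elim]
      norm_num [add_comm]) hJ
    obtain ⟨x, hx, hxR⟩ := exists_delayed hseq.1 hκ (hmem z) (hmem v) (hmem w)
      (by simp [v, w]) (by simp [i₁, i₂, v, tightTime, d0, d1, r0, r1, hlast, hzg])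
      (by simp [i₁, i₂, w, tightTime, d0, d1, r0, r1, hlast, hzg])
      (by simp [i₁, v, tightTime, d0, r0]) (by simp [i₁, w, tightTime, d0, d1, r0, r1]) hR
    have hpx : (tightInst m β hβ).p i₁ x = 1 / 2 := by
      rcases hx with rfl | rfl
      · simp [i₁, v, tightTime, d0, r0]
      · simp [i₁, w, tightTime, d0, d1, r0, r1]
    have hxS : x ∈ S := by
      rcases hx with rfl | rfl
      · exact hmem v
      · exact hmem w
    have hxu : (tightInst m β hβ).p i₁ x + (tightInst m β hβ).p i₂ x <
        (tightInst m β hβ).p i₁ (some u) + (tightInst m β hβ).p i₂ (some u) := by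
      rcases hx with rfl | rfl
      · simp [i₁, i₂, u, v, tightTime, d0, d1, d2, r0, r1, r2, hlast]; norm_num
      · simp [i₁, i₂, u, w, tightTime, d0, d1, d2, r0, r1, r2, hlast]; norm_num
    have h1 : _ + _ ≤ (tightInst m β hβ).earliest seq i₁ (some u) :=
      seqStart_add_le (r := (tightInst m β hβ).ready seq i₁)
      ((tightInst m β hβ).p_nonneg i₁) 0 _ hκ ((hseq.1 i₁).mem_iff.2 hxS)
      ((hseq.1 i₁).mem_iff.2 (hmem u)) (by rintro rfl; exact lt_irrefl _ hxu) (not_le.2 hxu)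
    change (tightInst m β hβ).earliest seq i₁ x + _ ≤ _ at h1
    have h2 := ready_succ (I := tightInst m β hβ) (seq := seq) i₁ (some u)
    have h3 := (tightInst m β hβ).p_nonneg i₁ (some u)
    have h4 : (tightInst m β hβ).ready seq (3 * g + 1) (some u) ≤ _ :=
      ready_le_earliest hseq.1 i₂ (hmem u)
    have h5 := ready_succ (I := tightInst m β hβ) (seq := seq) i₂ (some u)
    have h6 : (tightInst m β hβ).p i₂ (some u) = 1 := by
      simp [i₂, u, tightTime, d1, d2, r1, r2, hlast]
    have h7 := ready_mono_succ hseq.1 (3 * g + 2) (hmem u)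
    refine ⟨u, Or.inl (by simp only [u]; omega), ?_⟩
    change (tightInst m β hβ).ready seq (3 * g + 1) (some u) = _ at h2
    change (tightInst m β hβ).ready seq (3 * g + 2) (some u) = _ at h5
    rw [show 3 * (g + 1) = 3 * g + 2 + 1 by ring]
    push_cast
    rw [hpx] at h1
    linarith

/-- The late job leaves the triples at `2 * (m / 3)` or later. On the remaining machines the second
of the two jobs of length `1/2` adds `1` on the first and, for a pair, another `1/2` on the second.
A single machine needs `hsingle`, since its sequence is free. -/
theorem rho_le_makespan (hm : 0 < m) (hS : S = Finset.univ.map Function.Embedding.some)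
    (hseq : (tightInst m β hβ).IsSequencing S seq)
    (hsingle : m % 3 = 1 → ∀ i : Fin m, (i : ℕ) + 1 = m →
      (seq i).Pairwise (fun j k => (tightInst m β hβ).p i j ≤ (tightInst m β hβ).p i k)) :
    rho m ≤ (tightInst m β hβ).makespan S ((tightInst m β hβ).earliest seq) := by
  have hmem : ∀ j : Fin (m + 4), some j ∈ S := fun j => by simp [hS]
  obtain ⟨z, hz, hR⟩ := tight_group hS hseq (m / 3) (by omega)
  rw [rho_eq]
  set k := m / 3 with hk
  have hzk : k ≠ (z : ℕ) / 3 := by omega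
  rcases (by omega : m % 3 = 0 ∨ m % 3 ≠ 0) with h | h
  · have h1 := le_makespan ((tightInst m β hβ).earliest seq) ⟨m - 1, by omega⟩ (hmem z)
    rw [← ready_succ] at h1
    simp only at h1
    rw [show m - 1 + 1 = 3 * k by omega] at h1
    rw [if_pos h]
    linarith
  · let i₁ : Fin m := ⟨3 * k, by omega⟩
    let v : Fin (m + 4) := ⟨3 * k, by omega⟩
    let w : Fin (m + 4) := ⟨3 * k + 1, by omega⟩
    have d0 : 3 * k / 3 = k := by omega
    have d1 : (3 * k + 1) / 3 = k := by omega
    have r0 : 3 * k % 3 = 0 := by omega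
    have r1 : (3 * k + 1) % 3 = 1 := by omega
    have hκ : (seq i₁).Pairwise
        (fun j k => (tightInst m β hβ).p i₁ j ≤ (tightInst m β hβ).p i₁ k) := by
      by_cases h1 : m % 3 = 1
      · exact hsingle h1 i₁ (by simp only [i₁]; omega)
      · have hlast : 3 * k + 1 + 1 = m := by omega
        refine IsJohnsonOrder.pairwise_of_eq (fun j hj => ?_)
          (hseq.2.2 (by omega) i₁ ⟨3 * k + 1, by omega⟩ (by simp only [i₁]; omega) hlast).2
        rw [hS, Finset.mem_map] at hj
        obtain ⟨j, -, rfl⟩ := hj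
        simp [i₁, tightTime, d0, d1, r0, r1, hlast]
    obtain ⟨x, hx, hxR⟩ := exists_delayed hseq.1 hκ (hmem z) (hmem v) (hmem w)
      (by simp [v, w]) (by simp [i₁, v, tightTime, d0, r0, hzk])
      (by simp [i₁, w, tightTime, d0, d1, r0, r1, hzk])
      (by simp [i₁, v, tightTime, d0, r0]) (by simp [i₁, w, tightTime, d0, d1, r0, r1]) hR
    have hpx : (tightInst m β hβ).p i₁ x = 1 / 2 := by
      rcases hx with rfl | rfl
      · simp [i₁, v, tightTime, d0, r0]
      · simp [i₁, w, tightTime, d0, d1, r0, r1]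
    have hxS : x ∈ S := by
      rcases hx with rfl | rfl
      · exact hmem v
      · exact hmem w
    rw [if_neg h]
    by_cases h1 : m % 3 = 1
    · have := le_makespan ((tightInst m β hβ).earliest seq) i₁ hxS
      rw [if_pos h1]
      linarith
    · have hlast : 3 * k + 1 + 1 = m := by omega
      let i₂ : Fin m := ⟨3 * k + 1, by omega⟩
      have hpx2 : (tightInst m β hβ).p i₂ x = 1 / 2 := by
        rcases hx with rfl | rfl
        · simp [i₂, v, tightTime, d0, d1, r0, hlast]
        · simp [i₂, w, tightTime, d1, r1, hlast]
      have e1 := ready_succ (I := tightInst m β hβ) (seq := seq) i₁ x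
      have e2 : (tightInst m β hβ).ready seq (3 * k + 1) x ≤ _ :=
        ready_le_earliest hseq.1 i₂ hxS
      change (tightInst m β hβ).ready seq (3 * k + 1) x = _ at e1
      have := le_makespan ((tightInst m β hβ).earliest seq) i₂ hxS
      rw [if_neg h1]
      linarith

/-- If the subroutine may return the long path, then the ratio `ρ / β` is attained. -/
theorem exists_ratio_ge (hm : 0 < m) {ε : ℝ} (hβ0 : 0 < β) (hβ1 : β ≤ 1) (sub : Subroutine m)
    (hsub : ∀ P : List (Option (Fin (m + 4))), (tightInst m β hβ).IsSTPath P →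
      P.toFinset = Finset.univ.map Function.Embedding.some →
      sub (tightInst m β hβ) (tightInst m β hβ).p P) :
    ∃ r ∈ ratios m sub ε, rho m / β ≤ r := by
  obtain ⟨P, hP, hPS⟩ := exists_tightInst_path m β hβ
  obtain ⟨seq, hseq, hsingle⟩ := exists_sequencing (tightInst m β hβ) P.toFinset
  let x : Sol (tightInst m β hβ) := ⟨P, (tightInst m β hβ).earliest seq⟩
  have hρ := rho_pos hm
  have hx : rho m ≤ x.cmax := rho_le_makespan hm hPS hseq hsingle
  have hcur : IsCurrent sub ε (tightInst m β hβ) ∅ x := by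
    refine ⟨?_, seq, hseq, rfl⟩
    have : (tightInst m β hβ).weights ε ∅ = (tightInst m β hβ).p := by
      funext i a
      simp [Inst.weights]
    rw [this]
    exact hsub P hP hPS
  have hret : Returns sub ε (tightInst m β hβ) x := by
    refine ⟨0, ⟨x, x, ∅⟩, .init _ ⟨rfl, hcur, rfl⟩, ?_, rfl⟩
    rintro ⟨-, j, hj, hl⟩
    change j ∈ P.toFinset at hj
    rw [hPS, Finset.mem_map] at hj
    obtain ⟨j, -, rfl⟩ := hj
    -- A makespan of at least `ρ` puts the threshold at `1` or more, and no job is longer than `1`;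
    -- the loop is never entered.
    have h1 : 1 ≤ x.cmax / rho m := (one_le_div hρ).2 hx
    exact absurd (h1.trans_lt hl) (not_lt.2 (sum_tightTime_machines m j))
  have hopt := le_opt_tightInst (hβ := hβ) hm hβ1
  have hopt0 : 0 < (tightInst m β hβ).opt := hβ0.trans_le hopt
  refine ⟨_, ⟨_, x, hret, hopt0, rfl⟩, ?_⟩
  exact div_le_div₀ (hρ.le.trans hx) hx hopt0 opt_tightInst_le

/-! ### The long path as an answer of the subroutines. -/

theorem maxWeight_tight_path_le {P : List (Option (Fin (m + 4)))}
    (hPS : P.toFinset = Finset.univ.map Function.Embedding.some) :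
    (tightInst m β hβ).maxWeight (tightInst m β hβ).p P ≤ 1 := by
  refine maxWeight_le_iff.2 ⟨zero_le_one, fun i => ?_⟩
  rw [hPS, Finset.sum_map]
  exact (sum_tightTime_jobs i.2).le

theorem approxPath_tight (hm : 0 < m) {ε : ℝ} (hε : 0 < ε) (hβ1 : β ≤ 1)
    (hβε : 1 ≤ (1 + ε) * β) {P : List (Option (Fin (m + 4)))}
    (hP : (tightInst m β hβ).IsSTPath P)
    (hPS : P.toFinset = Finset.univ.map Function.Embedding.some) :
    approxPath ε (tightInst m β hβ) (tightInst m β hβ).p P := by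
  refine ⟨hP, fun P' hP' => (maxWeight_tight_path_le hPS).trans (hβε.trans ?_)⟩
  exact mul_le_mul_of_nonneg_left ((le_load_first hm hβ1 hP').trans (le_maxWeight _ _ _))
    (by linarith)

/-- Both alternatives have max weight `1`, and a sum of floors is at most the floor of the sum.
Rounding down can therefore only favour the long path over the single arc. -/
theorem abv_tight (hm : 0 < m) {ε : ℝ} (hε : 0 < ε) {P : List (Option (Fin (m + 4)))}
    (hP : (tightInst m 1 zero_le_one).IsSTPath P)
    (hPS : P.toFinset = Finset.univ.map Function.Embedding.some) :
    abv ε (tightInst m 1 zero_le_one) (tightInst m 1 zero_le_one).p P := by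
  have hp : (tightInst m 1 zero_le_one).p ⟨0, hm⟩ none = 1 := by simp
  set I := tightInst m 1 zero_le_one
  obtain ⟨Q, hQ, hmin⟩ := exists_min_path I (I.avgWeight I.p)
  have hL : 0 < I.avgWeight I.p Q := by
    refine div_pos ?_ (by exact_mod_cast hm)
    refine lt_of_lt_of_le zero_lt_one ((le_load_first hm le_rfl hQ).trans ?_)
    exact Finset.single_le_sum (f := fun i => ∑ a ∈ Q.toFinset, I.p i a)
      (fun i _ => Finset.sum_nonneg fun a _ => I.p_nonneg i a) (Finset.mem_univ _)
  refine ⟨Q, hQ, hmin, Or.inr ⟨hL.ne', hP, fun P' hP' => ?_⟩⟩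
  have hεL : 0 < ε * I.avgWeight I.p Q := mul_pos hε hL
  set D := ε * I.avgWeight I.p Q
  set n : ℝ := (Fintype.card I.V : ℝ)
  have hn : 0 ≤ n := Nat.cast_nonneg _
  have hf : ∀ i a, (0 : ℝ) ≤ ⌊n * I.p i a / D⌋ := fun i a => by
    exact_mod_cast Int.floor_nonneg.2 (div_nonneg (mul_nonneg hn (I.p_nonneg i a)) hεL.le)
  refine maxWeight_le_iff.2 ⟨maxWeight_nonneg _ _, fun i => ?_⟩
  rcases tightInst_path_dichotomy hP' with h | h
  · have h0 : (⌊n / D⌋ : ℝ) ≤ I.maxWeight (fun i a => (⌊n * I.p i a / D⌋ : ℝ)) P' := by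
      refine le_trans ?_ (le_maxWeight _ _ ⟨0, hm⟩)
      refine le_trans (le_of_eq ?_) (Finset.single_le_sum (fun a _ => hf ⟨0, hm⟩ a)
        (List.mem_toFinset.2 h))
      rw [hp, mul_one]
    refine le_trans ?_ h0
    rw [← Int.cast_sum]
    refine Int.cast_le.2 (Int.le_floor.2 ?_)
    rw [Int.cast_sum]
    calc ∑ a ∈ P.toFinset, (⌊n * I.p i a / D⌋ : ℝ) ≤ ∑ a ∈ P.toFinset, n * I.p i a / D :=
          Finset.sum_le_sum fun a _ => Int.floor_le _
      _ = n * (∑ a ∈ P.toFinset, I.p i a) / D := by rw [← Finset.sum_div, Finset.mul_sum]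
      _ ≤ n * 1 / D := by
          gcongr
          exact (le_maxWeight I.p P i).trans (maxWeight_tight_path_le hPS)
      _ = n / D := by rw [mul_one]
  · have hsub : P.toFinset ⊆ P'.toFinset := fun a ha => by
      rw [hPS, Finset.mem_map] at ha
      obtain ⟨j, -, rfl⟩ := ha
      exact List.mem_toFinset.2 (h j)
    exact (Finset.sum_le_sum_of_subset_of_nonneg hsub fun a _ _ => hf i a).trans
      (le_maxWeight (fun i a => (⌊n * I.p i a / D⌋ : ℝ)) P' i)

end TightSchedule

end FlowShopPath


theorem theorem3 (m : ℕ) (hm : 0 < m) (ε : ℝ) (hε : 0 < ε) :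
    -- PAR with the ABV subroutine, and with any other (1+ε)-approximate path subroutine
    (∀ sub : FlowShopPath.Subroutine m,
      (sub = FlowShopPath.abv ε ∨ sub = FlowShopPath.approxPath ε) →
      ∀ I : FlowShopPath.Inst m,
        -- every execution makes at most |A| passes, never gets stuck, and stops
        (∃ x, FlowShopPath.Returns sub ε I x) ∧
        (∀ k σ, FlowShopPath.Reaches sub ε I k σ →
          k ≤ Fintype.card I.A ∧ (σ.Guard → ∃ τ, FlowShopPath.IsStep sub ε I σ τ)) ∧
        -- every returned solution is feasible and within the factor (1+ε)ρ of the optimum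
        (∀ x, FlowShopPath.Returns sub ε I x →
          x.Feasible ∧ x.cmax ≤ (1 + ε) * FlowShopPath.rho m * I.opt)) ∧
    -- the worst-case ratio with the ABV subroutine is not below ρ
    (∀ b ∈ upperBounds (FlowShopPath.ratios m (FlowShopPath.abv ε) ε),
      FlowShopPath.rho m ≤ b) ∧
    -- if the path subroutine is only known to be (1+ε)-approximate, it is exactly (1+ε)ρ
    IsLUB (FlowShopPath.ratios m (FlowShopPath.approxPath ε) ε)
      ((1 + ε) * FlowShopPath.rho m) := by
  open FlowShopPath in
  have happrox : ∀ sub : Subroutine m, sub = abv ε ∨ sub = approxPath ε → ∀ I : Inst m,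
      ∀ D P, sub I (I.weights ε D) P → approxPath ε I (I.weights ε D) P := by
    rintro sub (rfl | rfl) I D P h
    · exact approxPath_of_abv hm hε (weights_nonneg hε I D) h
    · exact h
  have hexists : ∀ sub : FlowShopPath.Subroutine m,
      sub = FlowShopPath.abv ε ∨ sub = FlowShopPath.approxPath ε →
      ∀ (I : FlowShopPath.Inst m) w, ∃ P, sub I w P := by
    rintro sub (rfl | rfl) I w
    · exact FlowShopPath.exists_abv I w
    · exact FlowShopPath.exists_approxPath hε I w
  have hε1 : 0 < 1 + ε := by linarith
  refine ⟨fun sub hsub I => ⟨FlowShopPath.exists_returns (hexists sub hsub I),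
    fun k σ h => ⟨h.le_card, FlowShopPath.exists_isStep (hexists sub hsub I)⟩,
    fun x hx => hx.feasible_and_le hm hε (happrox sub hsub I)⟩, ?_, ?_, ?_⟩
  · intro b hb
    obtain ⟨r, hr, hle⟩ := FlowShopPath.exists_ratio_ge (ε := ε) (hβ := zero_le_one) hm
      zero_lt_one le_rfl (FlowShopPath.abv ε) fun P hP hPS => FlowShopPath.abv_tight hm hε hP hPS
    rw [div_one] at hle
    exact hle.trans (hb hr)
  · rintro r ⟨I, x, hx, hopt, rfl⟩
    rw [div_le_iff₀ hopt]
    exact (hx.feasible_and_le hm hε fun _ _ h => h).2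
  · intro b hb
    -- `1 / (1 + ε)` is the least `β` with `1 ≤ (1 + ε) * β`, the condition of `approxPath_tight`.
    have hβ0 : 0 < 1 / (1 + ε) := one_div_pos.2 hε1
    have hβ1 : 1 / (1 + ε) ≤ 1 := (div_le_one hε1).2 (by linarith)
    obtain ⟨r, hr, hle⟩ := FlowShopPath.exists_ratio_ge (ε := ε) (hβ := hβ0.le) hm hβ0 hβ1
      (FlowShopPath.approxPath ε) fun P hP hPS =>
        FlowShopPath.approxPath_tight hm hε hβ1 (mul_one_div_cancel hε1.ne').ge hP hPS
    rw [div_div_eq_mul_div, div_one, mul_comm] at hle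
    exact hle.trans (hb hr)
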